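/- Let $A$ be a (not necessarily unital or separable) $C^*$-algebra and let $I$ be a closed two-sided ideal of $A$. Write $\mathrm{Lat}(A)$ for the complete lattice of closed two-sided ideals of $A$ ordered by inclusion, $\mathrm{Ped}(I)$ for the Pedersen ideal of the $C^*$-algebra $I$ (its smallest dense two-sided ideal), and $\mathrm{Prim}(I)$ for the space of primitive ideals of $I$ with the hull-kernel topology. An element of $I$ is called full if the closed two-sided ideal it generates is $I$. The following are equivalent: (i) $I$ is singly generated (that is, generated by one element as a closed two-sided ideal) and is a compact element of $\mathrm{Lat}(A)$; (ii) $\mathrm{Ped}(I)$ contains a full element of $I$; (iii) $\mathrm{Prim}(I)$ is compact (every open cover has a finite subcover). Let $\mathrm{T}(A)$ be the cone of lower-semicontinuous traces on $A$, that is, of lower-semicontinuous maps $\tau\colon A_+\to[0,\infty]$ that are additive, compatible with multiplication by positive real numbers, and satisfy $\tau(0)=0$ and $\tau(xx^*)=\tau(x^*x)$ for all $x\in A$. Give it the pointwise operations and order, and the topology in which a net $(\tau_i)$ converges to $\tau$ if and only if $\limsup\tau_i((a-\epsilon)_+)\le\tau(a)\le\liminf\tau_i(a)$ for all $a\in A_+$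 and $\epsilon>0$. Let $\tau_I\in\mathrm{T}(A)$ be the trace that is $0$ on $I_+$ and $\infty$ on $A_+\setminus I$, and put $$\mathrm{T}_I(A)=\bigl\{\tau\in\mathrm{T}(A) : \sup\{e\in\mathrm{T}(A) : e+e=e,\ e\le\tau\}=\tau_I\bigr\}.$$ Each of (i), (ii), (iii) implies: (iv) $\mathrm{T}_I(A)$ is a subcone of $\mathrm{T}(A)$ with neutral element $\tau_I$ (it contains $\tau_I$, is closed under addition and under multiplication by positive real numbers, and $\tau+\tau_I=\tau$ for all $\tau\in\mathrm{T}_I(A)$); it is cancellative and locally compact; and it has a compact base. More precisely, $\mathrm{Ped}(I)$ contains a full positive element, and for every full positive element $e\in\mathrm{Ped}(I)$ the set $T_e(A)=\{\tau\in\mathrm{T}_I(A) : \tau(e)=1\}$ is a compact base of $\mathrm{T}_I(A)$: it is a compact convex subset of $\mathrm{T}_I(A)$, $\tau_I\notin T_e(A)$, and each $\tau\in\mathrm{T}_I(A)$ with $\tau\ne\tau_I$ can be written in exactly one way as $\tau=r\sigma$ with a real number $r>0$ and $\sigma\in T_e(A)$. -/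

import Mathlib

open scoped NNReal ENNReal

universe u

namespace CStarTrace

/-! ### Closed two-sided ideals and their lattice -/

section Ideals

variable (A : Type u) [NonUnitalCStarAlgebra A]

/-- A closed two-sided ideal of a C⋆-algebra: a norm-closed linear subspace that absorbs
multiplication from both sides. -/
structure ClosedIdeal extends Submodule ℂ A where
  mul_mem_left' : ∀ (x : A) {a : A}, a ∈ carrier → x * a ∈ carrier
  mul_mem_right' : ∀ (x : A) {a : A}, a ∈ carrier → a * x ∈ carrier
  isClosed' : IsClosed carrier

variable {A}

namespace ClosedIdeal

instance : SetLike (ClosedIdeal A) A where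
  coe I := I.carrier
  coe_injective I J h := by
    obtain ⟨⟨⟨⟨_, _⟩, _⟩, _⟩, _, _, _⟩ := I
    obtain ⟨⟨⟨⟨_, _⟩, _⟩, _⟩, _, _, _⟩ := J
    congr

/-- Closed ideals are ordered by inclusion. -/
instance : PartialOrder (ClosedIdeal A) := PartialOrder.ofSetLike (ClosedIdeal A) A

theorem isClosed (I : ClosedIdeal A) : IsClosed (I : Set A) := I.isClosed'

theorem mul_mem_left (I : ClosedIdeal A) (x : A) {a : A} (ha : a ∈ I) : x * a ∈ I :=
  I.mul_mem_left' x ha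

theorem mul_mem_right (I : ClosedIdeal A) (x : A) {a : A} (ha : a ∈ I) : a * x ∈ I :=
  I.mul_mem_right' x ha

instance : NonUnitalSubringClass (ClosedIdeal A) A where
  add_mem {I} _ _ ha hb := I.toSubmodule.add_mem ha hb
  zero_mem I := I.toSubmodule.zero_mem
  neg_mem {I} _ ha := I.toSubmodule.neg_mem ha
  mul_mem {I} a _ _ hb := I.mul_mem_left a hb

instance : SMulMemClass (ClosedIdeal A) ℂ A where
  smul_mem {I} r _ ha := I.toSubmodule.smul_mem r ha

/-- If `0 ≤ z⋆z ≤ y` and `y` lies in a closed ideal, then so does `z`. -/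
theorem mem_of_star_mul_self_le [PartialOrder A] [StarOrderedRing A] (I : ClosedIdeal A)
    {z y : A} (hzy : star z * z ≤ y) (hy : y ∈ I) : z ∈ I := by
  have hy0 : 0 ≤ y := (star_mul_self_nonneg z).trans hzy
  have hysa : IsSelfAdjoint y := IsSelfAdjoint.of_nonneg hy0
  -- functional calculus of `y` stays in `I`
  let S : NonUnitalStarSubalgebra ℝ A :=
    { carrier := {x | x ∈ I ∧ star x ∈ I}
      add_mem' := fun ha hb => ⟨add_mem ha.1 hb.1, by rw [star_add]; exact add_mem ha.2 hb.2⟩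
      zero_mem' := ⟨zero_mem I, by rw [star_zero]; exact zero_mem I⟩
      mul_mem' := fun {a b} ha hb =>
        ⟨I.mul_mem_left a hb.1, by rw [star_mul]; exact I.mul_mem_left _ ha.2⟩
      smul_mem' := fun c x hx => by
        refine ⟨?_, ?_⟩
        · have : c • x = (c : ℂ) • x := (Complex.coe_smul c x).symm
          rw [this]; exact SMulMemClass.smul_mem _ hx.1
        · have : star (c • x) = (c : ℂ) • star x := by
            rw [star_smul, star_trivial]; exact (Complex.coe_smul c (star x)).symm
          rw [this]; exact SMulMemClass.smul_mem _ hx.2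
      star_mem' := fun {x} hx => ⟨hx.2, by rw [star_star]; exact hx.1⟩ }
  have hS : IsClosed (S : Set A) :=
    I.isClosed.inter (I.isClosed.preimage (continuous_star (R := A)))
  have hyS : y ∈ S := ⟨hy, by rw [hysa.star_eq]; exact hy⟩
  have hcfc : ∀ f : ℝ → ℝ, cfcₙ f y ∈ I := fun f =>
    (NonUnitalStarAlgebra.elemental.le_of_mem hS hyS (cfcₙ_mem_elemental f y)).1
  rw [← SetLike.mem_coe, ← I.isClosed.closure_eq, Metric.mem_closure_iff]
  intro ε hε
  set δ : ℝ := ε ^ 2 / 4 with hδ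
  have hδ0 : 0 < δ := by positivity
  let f : ℝ → ℝ := fun t => min 1 (|t| / δ)
  have hf : Continuous f := by fun_prop
  have hf0 : f 0 = 0 := by simp [f]
  set v : A := cfcₙ f y with hv
  have hvsa : star v = v := (cfcₙ_predicate f y : IsSelfAdjoint v).star_eq
  refine ⟨z * v, I.mul_mem_left z (hcfc f), ?_⟩
  -- the compression `w ↦ (1 - v) w (1 - v)`
  let E : A → A := fun w => w - v * w - w * v + v * w * v
  have hE : ∀ c : A, E (star c * c) = star (c - c * v) * (c - c * v) := by
    intro c
    simp only [E, star_sub, star_mul, hvsa]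
    noncomm_ring
  have hpos : 0 ≤ E (star z * z) := by rw [hE]; exact star_mul_self_nonneg _
  have hle : E (star z * z) ≤ E y := by
    obtain ⟨c, hc⟩ := CStarAlgebra.nonneg_iff_eq_star_mul_self.mp (sub_nonneg.mpr hzy)
    have : E y - E (star z * z) = E (star c * c) := by
      rw [← hc]; simp only [E]; noncomm_ring
    rw [← sub_nonneg, this, hE]
    exact star_mul_self_nonneg _
  have hEy : E y = cfcₙ (fun t => t - f t * t - t * f t + f t * t * f t) y := by
    have hid : cfcₙ (fun t : ℝ => t) y = y := cfcₙ_id' ℝ y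
    have hc1 : cfcₙ (fun t => f t * t) y = v * y := by
      rw [cfcₙ_mul f (fun t => t) y (by fun_prop) hf0 (by fun_prop) rfl, hid]
    have hc2 : cfcₙ (fun t => t * f t) y = y * v := by
      rw [cfcₙ_mul (fun t => t) f y (by fun_prop) rfl (by fun_prop) hf0, hid]
    have hc3 : cfcₙ (fun t => f t * t * f t) y = v * y * v := by
      rw [cfcₙ_mul (fun t => f t * t) f y (by fun_prop) (by simp) (by fun_prop) hf0, hc1]
    rw [cfcₙ_add (fun t => t - f t * t - t * f t) (fun t => f t * t * f t) y
        (by fun_prop) (by simp) (by fun_prop) (by simp),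
      cfcₙ_sub (fun t => t - f t * t) (fun t => t * f t) y
        (by fun_prop) (by simp) (by fun_prop) (by simp),
      cfcₙ_sub (fun t => t) (fun t => f t * t) y
        (by fun_prop) rfl (by fun_prop) (by simp), hid, hc1, hc2, hc3]
  have hnorm : ‖E y‖ ≤ δ := by
    rw [hEy]
    refine norm_cfcₙ_le fun t _ => ?_
    have h1 : t - f t * t - t * f t + f t * t * f t = t * (1 - f t) ^ 2 := by ring
    rw [h1, norm_mul, norm_pow, Real.norm_eq_abs, Real.norm_eq_abs, sq_abs]
    rcases le_total 1 (|t| / δ) with h | h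
    · have : f t = 1 := min_eq_left h
      rw [this]; simp; exact hδ0.le
    · have hft : f t = |t| / δ := min_eq_right h
      have ht : |t| ≤ δ := by rwa [div_le_one hδ0] at h
      have h0 : 0 ≤ f t := by rw [hft]; positivity
      have h1' : f t ≤ 1 := by rw [hft]; exact h
      have hsq : (1 - f t) ^ 2 ≤ 1 := by nlinarith
      calc |t| * (1 - f t) ^ 2 ≤ δ * 1 := by gcongr
        _ = δ := mul_one δ
  have hfin : ‖z - z * v‖ * ‖z - z * v‖ ≤ δ := by
    rw [← CStarRing.norm_star_mul_self, ← hE]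
    exact (CStarAlgebra.norm_le_norm_of_nonneg_of_le hpos hle).trans hnorm
  rw [dist_eq_norm]
  by_contra hcon
  push Not at hcon
  nlinarith [norm_nonneg (z - z * v)]

/-- Closed two-sided ideals of a C⋆-algebra are self-adjoint. -/
instance : StarMemClass (ClosedIdeal A) A where
  star_mem {I} x hx := by
    let _ := CStarAlgebra.spectralOrder A
    let _ := CStarAlgebra.spectralOrderedRing A
    refine I.mem_of_star_mul_self_le (z := star x) le_rfl ?_
    rw [star_star]
    exact I.mul_mem_right _ hx

instance (I : ClosedIdeal A) : IsClosed (I : Set A) := I.isClosed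

/-- A closed two-sided ideal, regarded as a C⋆-algebra in its own right. -/
noncomputable instance (I : ClosedIdeal A) : NonUnitalCStarAlgebra I :=
  NonUnitalStarSubalgebra.nonUnitalCStarAlgebra I

theorem mem_of_nonneg_of_le [PartialOrder A] [StarOrderedRing A] (I : ClosedIdeal A)
    {a b : A} (ha : 0 ≤ a) (hab : a ≤ b) (hb : b ∈ I) : a ∈ I := by
  obtain ⟨c, rfl⟩ := CStarAlgebra.nonneg_iff_eq_star_mul_self.mp ha
  exact I.mul_mem_left _ (I.mem_of_star_mul_self_le hab hb)

theorem star_mul_self_mem_iff [PartialOrder A] [StarOrderedRing A] (I : ClosedIdeal A)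
    {x : A} : star x * x ∈ I ↔ x ∈ I :=
  ⟨fun h => I.mem_of_star_mul_self_le le_rfl h, fun h => I.mul_mem_left _ h⟩

instance : InfSet (ClosedIdeal A) where
  sInf s :=
    { carrier := ⋂ I ∈ s, (I : Set A)
      add_mem' := fun ha hb => by
        simp only [Set.mem_iInter, SetLike.mem_coe] at *
        exact fun I hI => add_mem (ha I hI) (hb I hI)
      zero_mem' := by
        simp only [Set.mem_iInter, SetLike.mem_coe]
        exact fun I _ => zero_mem I
      smul_mem' := fun c x hx => by
        simp only [Set.mem_iInter, SetLike.mem_coe] at *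
        exact fun I hI => SMulMemClass.smul_mem c (hx I hI)
      mul_mem_left' := fun x a ha => by
        simp only [Set.mem_iInter, SetLike.mem_coe] at *
        exact fun I hI => I.mul_mem_left x (ha I hI)
      mul_mem_right' := fun x a ha => by
        simp only [Set.mem_iInter, SetLike.mem_coe] at *
        exact fun I hI => I.mul_mem_right x (ha I hI)
      isClosed' := isClosed_biInter fun I _ => I.isClosed }

theorem mem_sInf {s : Set (ClosedIdeal A)} {a : A} : a ∈ sInf s ↔ ∀ I ∈ s, a ∈ I := by
  change a ∈ (⋂ I ∈ s, (I : Set A)) ↔ _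
  simp

/-- `Lat(A)`: the complete lattice of closed two-sided ideals, ordered by inclusion. -/
instance : CompleteLattice (ClosedIdeal A) :=
  completeLatticeOfInf _ fun _ =>
    ⟨fun I hI _ ha => mem_sInf.mp ha I hI,
      fun _ hJ _ ha => mem_sInf.mpr fun _ hI => hJ hI ha⟩

/-- The closed two-sided ideal generated by a set. -/
def span (s : Set A) : ClosedIdeal A := sInf {I | s ⊆ I}

/-- A closed ideal is singly generated if it is the closed two-sided ideal generated by one
element. -/
def IsSinglyGenerated (I : ClosedIdeal A) : Prop := ∃ a : A, I = span {a}

end ClosedIdeal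

/-- An element of a C⋆-algebra is full if it generates it as a closed two-sided ideal. -/
def IsFull (a : A) : Prop := ClosedIdeal.span {a} = ⊤

/-! ### The Pedersen ideal -/

/-- A linear subspace which is a (not necessarily closed) two-sided ideal. -/
def IsTwoSidedIdeal (J : Submodule ℂ A) : Prop :=
  ∀ x : A, ∀ a ∈ J, x * a ∈ J ∧ a * x ∈ J

variable (A) in
/-- The Pedersen ideal: the smallest dense two-sided ideal, that is, the intersection of all dense
two-sided ideals. -/
def pedersenIdeal : Submodule ℂ A :=
  sInf {J | IsTwoSidedIdeal J ∧ Dense (J : Set A)}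

/-! ### The primitive ideal space -/

/-- A ⋆-representation on a Hilbert space is irreducible if it is nonzero and has no closed
invariant subspaces other than `0` and the whole space. -/
def IsIrreducibleRep {H : Type u} [NormedAddCommGroup H] [InnerProductSpace ℂ H] [CompleteSpace H]
    (π : A →⋆ₙₐ[ℂ] (H →L[ℂ] H)) : Prop :=
  (∃ a, π a ≠ 0) ∧
    ∀ K : Submodule ℂ H, IsClosed (K : Set H) → (∀ a, ∀ ξ ∈ K, π a ξ ∈ K) → K = ⊥ ∨ K = ⊤

/-- A primitive ideal is the kernel of an irreducible ⋆-representation. -/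
def ClosedIdeal.IsPrimitive (P : ClosedIdeal A) : Prop :=
  ∃ (H : Type u) (_ : NormedAddCommGroup H) (_ : InnerProductSpace ℂ H) (_ : CompleteSpace H)
    (π : A →⋆ₙₐ[ℂ] (H →L[ℂ] H)), IsIrreducibleRep π ∧ ∀ a, a ∈ P ↔ π a = 0

variable (A) in
/-- `Prim(A)`, the set of primitive ideals of `A`. -/
def Prim : Type u := {P : ClosedIdeal A // P.IsPrimitive}

/-- The hull-kernel (Jacobson) topology on `Prim(A)`: the closed sets are the hulls
`{P | K ⊆ P}` of the closed ideals `K`. -/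
instance : TopologicalSpace (Prim A) :=
  TopologicalSpace.generateFrom {U | ∃ K : ClosedIdeal A, U = {P : Prim A | K ≤ P.1}ᶜ}

end Ideals

/-! ### Lower-semicontinuous traces -/

section Traces

variable (A : Type u) [NonUnitalCStarAlgebra A] [PartialOrder A] [StarOrderedRing A]

/-- The cone `A₊` of positive elements. -/
abbrev Pos : Type u := {a : A // 0 ≤ a}

/-- `T(A)`: lower-semicontinuous traces `A₊ → [0, ∞]`. -/
structure Trace where
  toFun : Pos A → ℝ≥0∞
  map_zero' : toFun 0 = 0
  map_add' : ∀ a b, toFun (a + b) = toFun a + toFun b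
  map_smul' : ∀ (r : ℝ≥0) (a : Pos A), 0 < r →
    toFun ⟨(r : ℝ) • a.1, smul_nonneg r.2 a.2⟩ = r * toFun a
  map_mul_star' : ∀ x : A,
    toFun ⟨x * star x, mul_star_self_nonneg x⟩ = toFun ⟨star x * x, star_mul_self_nonneg x⟩
  lsc' : LowerSemicontinuous toFun

variable {A}

namespace Trace

instance : FunLike (Trace A) (Pos A) ℝ≥0∞ where
  coe := toFun
  coe_injective σ τ h := by cases σ; cases τ; congr

@[ext] theorem ext {σ τ : Trace A} (h : ∀ a, σ a = τ a) : σ = τ := DFunLike.ext _ _ h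

/-- The pointwise order. -/
instance : PartialOrder (Trace A) := PartialOrder.lift (fun τ : Trace A => (τ : Pos A → ℝ≥0∞))
  DFunLike.coe_injective

/-- The zero trace. -/
instance : Zero (Trace A) where
  zero :=
    { toFun := fun _ => 0
      map_zero' := rfl
      map_add' := by simp
      map_smul' := by simp
      map_mul_star' := by simp
      lsc' := lowerSemicontinuous_const }

/-- Pointwise addition. -/
instance : Add (Trace A) where
  add σ τ :=
    { toFun := fun a => σ a + τ a
      map_zero' := by
        change σ.toFun 0 + τ.toFun 0 = 0
        rw [σ.map_zero', τ.map_zero', add_zero]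
      map_add' := fun a b => by
        change σ.toFun (a + b) + τ.toFun (a + b) = _
        rw [σ.map_add', τ.map_add']
        exact add_add_add_comm _ _ _ _
      map_smul' := fun r a hr => by
        change σ.toFun _ + τ.toFun _ = _
        rw [σ.map_smul' r a hr, τ.map_smul' r a hr]
        exact (mul_add _ _ _).symm
      map_mul_star' := fun x => by
        change σ.toFun _ + τ.toFun _ = _
        rw [σ.map_mul_star', τ.map_mul_star']
        rfl
      lsc' := σ.lsc'.add τ.lsc' }

/-- Pointwise multiplication by nonnegative scalars (with `0 * ∞ = 0`). -/
noncomputable instance : SMul ℝ≥0 (Trace A) where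
  smul c τ :=
    { toFun := fun a => (c : ℝ≥0∞) * τ a
      map_zero' := by
        change (c : ℝ≥0∞) * τ.toFun 0 = 0
        rw [τ.map_zero', mul_zero]
      map_add' := fun a b => by
        change (c : ℝ≥0∞) * τ.toFun (a + b) = _
        rw [τ.map_add']
        exact mul_add _ _ _
      map_smul' := fun r a hr => by
        change (c : ℝ≥0∞) * τ.toFun _ = _
        rw [τ.map_smul' r a hr]
        exact mul_left_comm _ _ _
      map_mul_star' := fun x => by
        change (c : ℝ≥0∞) * τ.toFun _ = _
        rw [τ.map_mul_star']
        rfl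
      lsc' := (ENNReal.continuous_const_mul ENNReal.coe_ne_top).comp_lowerSemicontinuous τ.lsc'
        fun _ _ h => mul_le_mul_right h _ }

@[simp] theorem zero_apply (a : Pos A) : (0 : Trace A) a = 0 := rfl

@[simp] theorem add_apply (σ τ : Trace A) (a : Pos A) : (σ + τ) a = σ a + τ a := rfl

@[simp] theorem smul_apply (c : ℝ≥0) (τ : Trace A) (a : Pos A) :
    (c • τ) a = (c : ℝ≥0∞) * τ a := rfl

noncomputable instance : AddCommMonoid (Trace A) where
  add_assoc _ _ _ := ext fun _ => add_assoc _ _ _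
  zero_add _ := ext fun _ => zero_add _
  add_zero _ := ext fun _ => add_zero _
  add_comm _ _ := ext fun _ => add_comm _ _
  nsmul := nsmulRec

noncomputable instance : Module ℝ≥0 (Trace A) where
  one_smul _ := ext fun _ => by simp
  mul_smul _ _ _ := ext fun _ => by simp [mul_assoc]
  smul_zero _ := ext fun _ => by simp
  smul_add _ _ _ := ext fun _ => by simp [mul_add]
  add_smul _ _ _ := ext fun _ => by simp [add_mul]
  zero_smul _ := ext fun _ => by simp

open Classical in
/-- The trace `τ_I`, which is `0` on `I₊` and `∞` elsewhere. -/
noncomputable def ofIdeal (I : ClosedIdeal A) : Trace A where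
  toFun a := if (a : A) ∈ I then 0 else ∞
  map_zero' := if_pos (zero_mem I)
  map_add' a b := by
    by_cases ha : (a : A) ∈ I
    · by_cases hb : (b : A) ∈ I
      · have : ((a + b : Pos A) : A) ∈ I := add_mem ha hb
        simp only [if_pos ha, if_pos hb, if_pos this, add_zero]
      · have : ((a + b : Pos A) : A) ∉ I := fun h =>
          hb (I.mem_of_nonneg_of_le b.2 (le_add_of_nonneg_left a.2) h)
        simp only [if_neg hb, if_neg this, add_top]
    · have : ((a + b : Pos A) : A) ∉ I := fun h =>
        ha (I.mem_of_nonneg_of_le a.2 (le_add_of_nonneg_right b.2) h)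
      simp only [if_neg ha, if_neg this, top_add]
  map_smul' r a hr := by
    have key : (r : ℝ) • (a : A) ∈ I ↔ (a : A) ∈ I := by
      rw [← Complex.coe_smul]
      refine ⟨fun h => ?_, fun h => SMulMemClass.smul_mem _ h⟩
      have h2 := SMulMemClass.smul_mem (((r : ℝ) : ℂ)⁻¹) h
      rwa [inv_smul_smul₀ (by exact_mod_cast hr.ne')] at h2
    by_cases ha : (a : A) ∈ I
    · simp only [key, if_pos ha, mul_zero]
    · simp only [key, if_neg ha]
      exact (ENNReal.mul_top (by exact_mod_cast hr.ne')).symm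
  map_mul_star' x := by
    have key : x * star x ∈ I ↔ star x * x ∈ I := by
      rw [I.star_mul_self_mem_iff]
      have := I.star_mul_self_mem_iff (x := star x)
      rw [star_star] at this
      rw [this]
      exact ⟨fun h => by simpa using star_mem h, fun h => star_mem h⟩
    simp only [key]
  lsc' := by
    have hcl : IsClosed {a : Pos A | (a : A) ∈ I} := I.isClosed.preimage continuous_subtype_val
    intro a r hr
    by_cases ha : (a : A) ∈ I
    · simp only [if_pos ha] at hr
      exact absurd hr not_lt_zero
    · simp only [if_neg ha] at hr
      filter_upwards [hcl.isOpen_compl.mem_nhds ha] with b hb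
      have hb' : (b : A) ∉ I := hb
      simpa only [if_neg hb'] using hr

/-! ### The topology of `T(A)` -/

/-- The cut-down `(a - ε)₊` of a positive element, for `ε > 0`. -/
noncomputable def cutDown (a : Pos A) (ε : ℝ) : Pos A :=
  ⟨cfcₙ (fun t : ℝ => max 0 (t - ε)) a.1, cfcₙ_nonneg fun _ _ => le_max_left _ _⟩

/-- Convergence of a filter `F` on `T(A)` (equivalently, of a net in `T(A)`) to `τ`:
`limsup σ((a - ε)₊) ≤ τ(a) ≤ liminf σ(a)` along `F`, for every `a ∈ A₊` and every `ε > 0`. -/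
def ConvergesTo (F : Filter (Trace A)) (τ : Trace A) : Prop :=
  ∀ (a : Pos A) (ε : ℝ), 0 < ε →
    Filter.limsup (fun σ : Trace A => σ (cutDown a ε)) F ≤ τ a ∧
      τ a ≤ Filter.liminf (fun σ : Trace A => σ a) F

/-- The topology on `T(A)` in which a net converges precisely in the sense of `ConvergesTo`:
a set is open if and only if it belongs to every filter that converges to one of its points. -/
instance : TopologicalSpace (Trace A) where
  IsOpen U := ∀ τ ∈ U, ∀ F : Filter (Trace A), ConvergesTo F τ → U ∈ F
  isOpen_univ := fun _ _ _ _ => Filter.univ_mem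
  isOpen_inter := fun _ _ hU hV τ hτ F hF =>
    Filter.inter_mem (hU τ hτ.1 F hF) (hV τ hτ.2 F hF)
  isOpen_sUnion := fun _ hs τ ⟨U, hU, hτ⟩ F hF =>
    Filter.mem_of_superset (hs U hU τ hτ F hF) (Set.subset_sUnion_of_mem hU)

theorem mono (τ : Trace A) {a b : Pos A} (h : (a : A) ≤ b) : τ a ≤ τ b := by
  have hb : b = a + ⟨(b : A) - a, sub_nonneg.mpr h⟩ := by
    apply Subtype.ext
    change (b : A) = a + (b - a)
    abel
  rw [hb]
  change τ.toFun a ≤ τ.toFun _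
  rw [τ.map_add']
  exact le_self_add

theorem cutDown_cutDown (a : Pos A) {s t : ℝ} (hs : 0 ≤ s) (ht : 0 ≤ t) :
    cutDown (cutDown a s) t = cutDown a (s + t) := by
  apply Subtype.ext
  have ha : IsSelfAdjoint (a : A) := IsSelfAdjoint.of_nonneg a.2
  change cfcₙ _ (cfcₙ _ (a : A)) = cfcₙ _ (a : A)
  rw [← cfcₙ_comp' (fun x : ℝ => max 0 (x - t)) (fun x : ℝ => max 0 (x - s)) (a : A)
    (by fun_prop) (by simp [ht]) (by fun_prop) (by simp [hs])]
  congr 1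
  funext x
  rcases max_cases 0 (x - s) with h | h <;> rcases max_cases 0 (x - (s + t)) with h' | h' <;>
    rw [h.1, h'.1] <;> first
      | (apply max_eq_left; linarith)
      | (rw [max_eq_right] <;> linarith)

theorem cutDown_le (a : Pos A) {s t : ℝ} (hs : 0 ≤ s) (hst : s ≤ t) :
    (cutDown a t : A) ≤ cutDown a s :=
  cfcₙ_mono (fun x _ => max_le_max le_rfl (by linarith))
    (by fun_prop) (by fun_prop) (by simp [hs.trans hst]) (by simp [hs])

theorem cutDown_zero (a : Pos A) : cutDown a 0 = a := by
  apply Subtype.ext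
  have ha : IsSelfAdjoint (a : A) := IsSelfAdjoint.of_nonneg a.2
  change cfcₙ _ (a : A) = a
  conv_rhs => rw [← cfcₙ_id' ℝ (a : A)]
  refine cfcₙ_congr fun x hx => ?_
  have : 0 ≤ x := quasispectrum_nonneg_of_nonneg (a : A) a.2 x hx
  simp [this]

/-- Convergence in the topology of `T(A)` is exactly `ConvergesTo`. -/
theorem le_nhds_iff (F : Filter (Trace A)) (τ : Trace A) : F ≤ nhds τ ↔ ConvergesTo F τ := by
  constructor
  · intro hF a ε hε
    constructor
    · refine le_of_forall_gt_imp_ge_of_dense fun r hr => ?_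
      have hO : IsOpen {σ : Trace A | ∃ t, 0 ≤ t ∧ t < ε ∧ σ (cutDown a t) < r} := by
        rintro ρ ⟨t, ht0, ht, hρ⟩ G hG
        have h := (hG (cutDown a t) ((ε - t) / 2) (by linarith)).1.trans_lt hρ
        filter_upwards [Filter.eventually_lt_of_limsup_lt h] with σ hσ
        rw [cutDown_cutDown a ht0 (by linarith)] at hσ
        exact ⟨_, by linarith, by linarith, hσ⟩
      have hm := hF (hO.mem_nhds ⟨0, le_rfl, hε, by rwa [cutDown_zero]⟩)
      refine Filter.limsup_le_of_le (by isBoundedDefault) ?_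
      filter_upwards [hm] with σ hσ
      obtain ⟨t, ht0, ht, hσ⟩ := hσ
      exact (σ.mono (cutDown_le a ht0 ht.le)).trans hσ.le
    · refine le_of_forall_lt_imp_le_of_dense fun r hr => ?_
      have hO : IsOpen {σ : Trace A | r < σ a} := by
        intro ρ hρ G hG
        exact Filter.eventually_lt_of_lt_liminf (lt_of_lt_of_le hρ (hG a 1 one_pos).2)
      refine Filter.le_liminf_of_le (by isBoundedDefault) ?_
      filter_upwards [hF (hO.mem_nhds hr)] with σ hσ
      exact le_of_lt hσ
  · intro h U hU
    obtain ⟨V, hVU, hV, hτ⟩ := mem_nhds_iff.mp hU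
    exact Filter.mem_of_superset (hV τ hτ F h) hVU

/-! ### The subcones `T_I(A)` and their bases -/

/-- `T_I(A)`: the lower-semicontinuous traces whose support idempotent
`ε(τ) = sup {e ∈ T(A) | 2e = e ≤ τ}` is `τ_I`. -/
def supportedOn (I : ClosedIdeal A) : Set (Trace A) :=
  {τ | IsLUB {e : Trace A | e + e = e ∧ e ≤ τ} (ofIdeal I)}

/-- `C` is a subcone of `T(A)` with neutral element `z`: it is closed under addition and under
multiplication by positive scalars, it contains `z`, and `z` is neutral for its addition. -/
structure IsSubcone (C : Set (Trace A)) (z : Trace A) : Prop where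
  add_mem : ∀ σ ∈ C, ∀ τ ∈ C, σ + τ ∈ C
  smul_mem : ∀ r : ℝ≥0, 0 < r → ∀ τ ∈ C, r • τ ∈ C
  neutral_mem : z ∈ C
  add_neutral : ∀ τ ∈ C, τ + z = τ

/-- The addition of `C` is cancellative. -/
def IsCancellative (C : Set (Trace A)) : Prop :=
  ∀ ρ ∈ C, ∀ σ ∈ C, ∀ τ ∈ C, σ + ρ = τ + ρ → σ = τ

/-- `T` is a compact base of the cone `C` with neutral element `z`: a compact convex subset
of `C` not containing `z`, such that every element of `C` other than `z` is a positive multiple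
of an element of `T` in exactly one way. -/
structure IsCompactBase (C : Set (Trace A)) (z : Trace A) (T : Set (Trace A)) : Prop where
  subset : T ⊆ C
  isCompact : IsCompact T
  convex : Convex ℝ≥0 T
  neutral_notMem : z ∉ T
  existsUnique : ∀ τ ∈ C, τ ≠ z → ∃! p : ℝ≥0 × Trace A, 0 < p.1 ∧ p.2 ∈ T ∧ p.1 • p.2 = τ

/-- `T_e(A)`: the traces in `T_I(A)` with value `1` at `e`. -/
def normalizedAt (I : ClosedIdeal A) (e : Pos A) : Set (Trace A) :=
  {τ | τ ∈ supportedOn I ∧ τ e = 1}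

end Trace

end Traces

end CStarTrace

namespace CStarTrace

/-! ### Two-sided ideals and their closures -/

section TwoSidedIdeals

variable {A : Type u} [NonUnitalCStarAlgebra A]

/-! The cut-downs `(a - ε)₊` drive both halves. A function of `a` that equals 1 on `[ε, ∞)` is a
unit for `(a - ε)₊`, and an element with a local unit in the closure of a two-sided ideal already
lies in that ideal (`IsTwoSidedIdeal.mem_of_mul_eq_self`). Hence cut-downs lie in the Pedersen
ideal, while every closed ideal containing all cut-downs of `a` contains `a`.

Equivalence of (i), (ii), (iii). If `I` is compact in the lattice and generated by `b ≥ 0`, it is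
the directed supremum of the ideals generated by the `(b - ε)₊`, so a single cut-down is full and
lies in `Ped(I)`. Conversely, the union of a directed family whose closure contains `I` meets `I` in
a dense ideal, which contains `Ped(I)`; a full element of `Ped(I)` therefore lies in one member of
the family. Compactness of `Prim(I)` translates into compactness of the top ideal of `I` because
every closed ideal is an intersection of primitive ideals. That fact is proved by separating with
Hahn–Banach, passing to extreme states by Krein–Milman, and showing that their GNS representations
are irreducible.

The cone. The support idempotent of `τ` is `τ_J`, where `J` is the closed ideal generated by the
positive elements of finite trace; so `T_I(A)` consists of the traces that are finite on cut-downs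
of elements of `I₊` and infinite off `I` (`mem_supportedOn_iff`). The subcone and cancellation
properties follow by computing on cut-downs and using lower semicontinuity; they hold for every `I`.

Compactness. An ultrafilter of traces has a pointwise limit `f`, which is tracial but perhaps not
lower semicontinuous; its regularization `a ↦ sup_ε f((a - ε)₊)` is a trace, and the ultrafilter
converges to it. If `e` is full, every cut-down of an element of `I₊` has trace at most a constant
times the trace of `e`, uniformly in the trace, so a bound at `e` keeps the limit in `T_I(A)`. If
moreover `e ∈ Ped(I)`, then `f` and its regularization agree at `e`, so the normalization at `e`
survives in the limit. -/

theorem ClosedIdeal.real_smul_mem (I : ClosedIdeal A) (c : ℝ) {x : A} (hx : x ∈ I) :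
    c • x ∈ I := by
  rw [← Complex.coe_smul]
  exact SMulMemClass.smul_mem _ hx

/-- Closed ideals are closed under the continuous functional calculus. -/
theorem ClosedIdeal.cfcₙ_mem (I : ClosedIdeal A) {y : A} (hy : y ∈ I) (hsa : IsSelfAdjoint y)
    (f : ℝ → ℝ) : cfcₙ f y ∈ I := by
  let S : NonUnitalStarSubalgebra ℝ A :=
    { carrier := {x | x ∈ I ∧ star x ∈ I}
      add_mem' := fun ha hb => ⟨add_mem ha.1 hb.1, by rw [star_add]; exact add_mem ha.2 hb.2⟩
      zero_mem' := ⟨zero_mem I, by rw [star_zero]; exact zero_mem I⟩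
      mul_mem' := fun {a b} ha hb =>
        ⟨I.mul_mem_left a hb.1, by rw [star_mul]; exact I.mul_mem_left _ ha.2⟩
      smul_mem' := fun c x hx => ⟨I.real_smul_mem c hx.1, by
        rw [star_smul, star_trivial]; exact I.real_smul_mem c hx.2⟩
      star_mem' := fun {x} hx => ⟨hx.2, by rw [star_star]; exact hx.1⟩ }
  have hS : IsClosed (S : Set A) :=
    I.isClosed.inter (I.isClosed.preimage (continuous_star (R := A)))
  have hyS : y ∈ S := ⟨hy, by rw [hsa.star_eq]; exact hy⟩
  exact (NonUnitalStarAlgebra.elemental.le_of_mem hS hyS (cfcₙ_mem_elemental f y)).1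

theorem ClosedIdeal.subset_span (s : Set A) : s ⊆ ClosedIdeal.span s := fun _ ha =>
  ClosedIdeal.mem_sInf.mpr fun _ hI => hI ha

theorem ClosedIdeal.span_le {s : Set A} {I : ClosedIdeal A} : ClosedIdeal.span s ≤ I ↔ s ⊆ I :=
  ⟨fun h => (subset_span s).trans h, fun h => sInf_le h⟩

theorem ClosedIdeal.span_singleton_le {a : A} {I : ClosedIdeal A} :
    ClosedIdeal.span {a} ≤ I ↔ a ∈ I := by
  rw [span_le, Set.singleton_subset_iff, SetLike.mem_coe]

theorem ClosedIdeal.mem_span_singleton_self (a : A) : a ∈ ClosedIdeal.span {a} :=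
  subset_span {a} rfl

theorem ClosedIdeal.mem_top (a : A) : a ∈ (⊤ : ClosedIdeal A) := by
  have : (⊤ : ClosedIdeal A) = sInf ∅ := sInf_empty.symm
  rw [this]
  exact mem_sInf.mpr fun _ h => h.elim

/-- The closure of a two-sided ideal. -/
def IsTwoSidedIdeal.closure {J : Submodule ℂ A} (hJ : IsTwoSidedIdeal J) : ClosedIdeal A where
  toSubmodule := J.topologicalClosure
  mul_mem_left' x _ ha := map_mem_closure (continuous_const_mul x) ha fun b hb => (hJ x b hb).1
  mul_mem_right' x _ ha := map_mem_closure (f := fun y : A => y * x) (continuous_mul_const x) ha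
    fun b hb => (hJ x b hb).2
  isClosed' := isClosed_closure

theorem IsTwoSidedIdeal.mem_closure {J : Submodule ℂ A} (hJ : IsTwoSidedIdeal J) {a : A} :
    a ∈ hJ.closure ↔ a ∈ _root_.closure (J : Set A) := Iff.rfl

theorem IsTwoSidedIdeal.subset_closure {J : Submodule ℂ A} (hJ : IsTwoSidedIdeal J) {a : A}
    (ha : a ∈ J) : a ∈ hJ.closure := _root_.subset_closure ha

/-- If `g` is a local left unit for `e`, then `e` lies in every two-sided ideal whose closure
contains `g`. -/
theorem IsTwoSidedIdeal.mem_of_mul_eq_self {J : Submodule ℂ A} (hJ : IsTwoSidedIdeal J)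
    {g e : A} (hg : g ∈ hJ.closure) (hge : g * e = e) : e ∈ J := by
  obtain ⟨x, hx, hgx⟩ := Metric.mem_closure_iff.mp hg 1 one_pos
  -- Since `‖g - x‖ < 1`, the element `1 - (g - x)` is invertible in the unitization, and it sends
  -- `e` to `x * e`, which lies in `J`. Its inverse is a scalar plus an element of `A`, so applying
  -- it stays in `J`.
  have hn : ‖((g - x : A) : Unitization ℂ A)‖ < 1 := by
    rwa [Unitization.norm_inr, ← dist_eq_norm]
  obtain ⟨u, hu⟩ := isUnit_one_sub_of_norm_lt_one hn
  have h1 : (u : Unitization ℂ A) * (e : Unitization ℂ A) = ((x * e : A) : Unitization ℂ A) := by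
    rw [hu, sub_mul, one_mul, ← Unitization.inr_mul, sub_mul, hge, ← Unitization.inr_sub]
    congr 1
    abel
  have h2 : (e : Unitization ℂ A) =
      (↑u⁻¹ : Unitization ℂ A) * ((x * e : A) : Unitization ℂ A) := by
    rw [← h1, Units.inv_mul_cancel_left]
  have h3 := congrArg (fun z : Unitization ℂ A => z.snd) h2
  rw [Unitization.snd_inr, Unitization.snd_mul, Unitization.snd_inr, Unitization.fst_inr,
    zero_smul, add_zero] at h3
  have hxe : x * e ∈ J := (hJ e x hx).2
  rw [h3]
  exact J.add_mem (J.smul_mem _ hxe) (hJ _ _ hxe).1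

/-- The closure of a dense ideal contains the local unit `g`. This is the source of all Pedersen
elements constructed below. -/
theorem mem_pedersenIdeal_of_mul_eq_self {g e : A} (hge : g * e = e) : e ∈ pedersenIdeal A := by
  refine Submodule.mem_sInf.mpr fun J hJ => ?_
  exact hJ.1.mem_of_mul_eq_self (hJ.1.mem_closure.mpr (hJ.2 g)) hge

theorem IsTwoSidedIdeal.pedersenIdeal_le {J : Submodule ℂ A} (hJ : IsTwoSidedIdeal J)
    (hd : Dense (J : Set A)) : pedersenIdeal A ≤ J := sInf_le ⟨hJ, hd⟩

variable (A) in
/-- A C⋆-algebra is spanned by the elements of the form `c⋆c`. -/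
theorem span_star_mul_self : Submodule.span ℂ {a : A | ∃ c, a = star c * c} = ⊤ := by
  let _ := CStarAlgebra.spectralOrder A
  let _ := CStarAlgebra.spectralOrderedRing A
  rw [← CStarAlgebra.span_nonneg (A := A)]
  congr 1
  ext a
  exact CStarAlgebra.nonneg_iff_eq_star_mul_self.symm

/-- A directed supremum of closed ideals is the closure of the union. -/
theorem ClosedIdeal.exists_sSup_eq_closure {D : Set (ClosedIdeal A)} (hne : D.Nonempty)
    (hD : DirectedOn (· ≤ ·) D) : ∃ (U : Submodule ℂ A) (hU : IsTwoSidedIdeal U),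
      (∀ a, a ∈ U ↔ ∃ J ∈ D, a ∈ J) ∧ sSup D = hU.closure := by
  let U : Submodule ℂ A := sSup (ClosedIdeal.toSubmodule '' D)
  have hmem : ∀ a, a ∈ U ↔ ∃ J ∈ D, a ∈ J := by
    intro a
    rw [Submodule.mem_sSup_of_directed (hne.image _)]
    · simp only [Set.exists_mem_image]; rfl
    · rintro _ ⟨J, hJ, rfl⟩ _ ⟨K, hK, rfl⟩
      obtain ⟨L, hL, h1, h2⟩ := hD J hJ K hK
      exact ⟨_, ⟨L, hL, rfl⟩, h1, h2⟩
  have hU : IsTwoSidedIdeal U := by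
    intro x a ha
    obtain ⟨J, hJ, haJ⟩ := (hmem a).mp ha
    exact ⟨(hmem _).mpr ⟨J, hJ, J.mul_mem_left x haJ⟩, (hmem _).mpr ⟨J, hJ, J.mul_mem_right x haJ⟩⟩
  refine ⟨U, hU, hmem, le_antisymm (sSup_le fun J hJ a ha => ?_) fun a ha => ?_⟩
  · exact hU.subset_closure ((hmem a).mpr ⟨J, hJ, ha⟩)
  · refine closure_minimal (fun b hb => ?_) (sSup D).isClosed ha
    obtain ⟨J, hJ, hb⟩ := (hmem b).mp hb
    exact le_sSup hJ hb

end TwoSidedIdeals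

/-! ### Functional calculus of positive elements -/

section FunctionalCalculus

variable {A : Type u} [NonUnitalCStarAlgebra A] [PartialOrder A] [StarOrderedRing A]

theorem cfcₙ_congr_of_nonneg {a : A} (ha : 0 ≤ a) {f g : ℝ → ℝ} (h : ∀ t, 0 ≤ t → f t = g t) :
    cfcₙ f a = cfcₙ g a :=
  cfcₙ_congr fun x hx => h x (quasispectrum_nonneg_of_nonneg a ha x hx)

theorem cfcₙ_mono_of_nonneg {a : A} (ha : 0 ≤ a) {f g : ℝ → ℝ} (hf : Continuous f)
    (hg : Continuous g) (hf0 : f 0 = 0) (hg0 : g 0 = 0) (h : ∀ t, 0 ≤ t → f t ≤ g t) :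
    cfcₙ f a ≤ cfcₙ g a :=
  cfcₙ_mono (fun x hx => h x (quasispectrum_nonneg_of_nonneg a ha x hx)) hf.continuousOn
    hg.continuousOn hf0 hg0

/-- A positive contraction in the functional calculus of `a` that is a unit for all functions of
`a` vanishing on `[0, ε]`. -/
noncomputable def plateau (a : A) (ε : ℝ) : A := cfcₙ (fun t : ℝ => max 0 (min 1 (t / ε))) a

theorem plateau_mul_cfcₙ {a : A} (ha : 0 ≤ a) {ε : ℝ} (hε : 0 < ε) {f : ℝ → ℝ} (hf : Continuous f)
    (h : ∀ t, t ≤ ε → f t = 0) : plateau a ε * cfcₙ f a = cfcₙ f a := by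
  have hsa : IsSelfAdjoint a := .of_nonneg ha
  have h0 : f 0 = 0 := h 0 hε.le
  rw [plateau, ← cfcₙ_mul (fun t : ℝ => max 0 (min 1 (t / ε))) f a (by fun_prop) (by simp)
    (by fun_prop) h0]
  congr 1
  funext t
  rcases le_total t ε with ht | ht
  · rw [h t ht, mul_zero]
  · rw [min_eq_left ((one_le_div hε).mpr ht), max_eq_right zero_le_one, one_mul]

namespace Trace

theorem coe_cutDown (a : Pos A) (ε : ℝ) :
    (cutDown a ε : A) = cfcₙ (fun t : ℝ => max 0 (t - ε)) (a : A) := rfl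

theorem norm_sub_cutDown_le (a : Pos A) {ε : ℝ} (hε : 0 ≤ ε) :
    ‖(a : A) - cutDown a ε‖ ≤ ε := by
  have hsa : IsSelfAdjoint (a : A) := .of_nonneg a.2
  have hid : cfcₙ (fun t : ℝ => t) (a : A) = a := cfcₙ_id' ℝ (a : A)
  nth_rw 1 [← hid]
  rw [coe_cutDown, ← cfcₙ_sub (fun t => t) (fun t : ℝ => max 0 (t - ε)) (a : A) (by fun_prop) rfl
    (by fun_prop) (by simp [hε])]
  refine norm_cfcₙ_le fun t ht => ?_
  have ht0 : 0 ≤ t := quasispectrum_nonneg_of_nonneg (a : A) a.2 t ht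
  rw [Real.norm_eq_abs, abs_le]
  rcases max_cases 0 (t - ε) with h | h <;> rw [h.1] <;> constructor <;> linarith

theorem cutDown_le_self (a : Pos A) {ε : ℝ} (hε : 0 ≤ ε) : (cutDown a ε : A) ≤ a := by
  conv_rhs => rw [← cutDown_zero a]
  exact cutDown_le a le_rfl hε

theorem plateau_mul_cutDown (a : Pos A) {ε : ℝ} (hε : 0 < ε) :
    plateau (a : A) ε * cutDown a ε = cutDown a ε :=
  plateau_mul_cfcₙ a.2 hε (by fun_prop) fun t ht => by simp [ht]

theorem cutDown_mem (I : ClosedIdeal A) {a : Pos A} (ha : (a : A) ∈ I) (ε : ℝ) :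
    (cutDown a ε : A) ∈ I := I.cfcₙ_mem ha (.of_nonneg a.2) _

/-- The cut-downs of `a` converge to `a` in norm, and `I` is closed. -/
theorem mem_of_forall_cutDown_mem (I : ClosedIdeal A) {a : Pos A}
    (h : ∀ ε, 0 < ε → (cutDown a ε : A) ∈ I) : (a : A) ∈ I := by
  rw [← SetLike.mem_coe, ← I.isClosed.closure_eq, Metric.mem_closure_iff]
  intro ε hε
  refine ⟨_, h (ε / 2) (by linarith), ?_⟩
  rw [dist_eq_norm]
  exact (norm_sub_cutDown_le a (by linarith)).trans_lt (by linarith)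

theorem plateau_mem (I : ClosedIdeal A) {a : A} (ha0 : 0 ≤ a) (ha : a ∈ I) (ε : ℝ) :
    plateau a ε ∈ I := I.cfcₙ_mem ha (.of_nonneg ha0) _

theorem cutDown_mem_pedersenIdeal (I : ClosedIdeal A) {a : Pos A} (ha : (a : A) ∈ I) {ε : ℝ}
    (hε : 0 < ε) : (⟨cutDown a ε, cutDown_mem I ha ε⟩ : I) ∈ pedersenIdeal I :=
  mem_pedersenIdeal_of_mul_eq_self (g := ⟨plateau a ε, plateau_mem I a.2 ha ε⟩)
    (Subtype.ext (plateau_mul_cutDown a hε))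

end Trace

end FunctionalCalculus


/-! ### States vanishing on an ideal -/

section States

variable {A : Type u} [NonUnitalCStarAlgebra A] [PartialOrder A] [StarOrderedRing A]

open Trace in
/-- If the positive element `a` is not in the closed ideal `K`, then `-a` is not a limit of sums of
positive elements and self-adjoint elements of `K`. -/
theorem ClosedIdeal.neg_notMem_closure (K : ClosedIdeal A) {a : A} (ha : 0 ≤ a) (haK : a ∉ K) :
    -a ∉ closure {x : A | ∃ p, 0 ≤ p ∧ ∃ k ∈ K, IsSelfAdjoint k ∧ x = p + k} := by
  intro h
  refine haK (mem_of_forall_cutDown_mem K (a := ⟨a, ha⟩) fun ε hε => ?_)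
  have hasa : IsSelfAdjoint a := .of_nonneg ha
  obtain ⟨_, ⟨p, hp, k, hk, hksa, rfl⟩, hd⟩ := Metric.mem_closure_iff.mp h ε hε
  set r := a + p + k with hr
  have hrsa : IsSelfAdjoint r := (hasa.add (.of_nonneg hp)).add hksa
  have hrn : ‖r‖ ≤ ε := by
    rw [dist_eq_norm, ← norm_neg] at hd
    have : -(-a - (p + k)) = r := by rw [hr]; abel
    rw [this] at hd
    exact hd.le
  -- Compress by `w`, the square root of `(a - ε)₊`. Then `w a w - ε w²` is the square of `(a -
  -- ε)₊`, whereas `‖a + p + k‖ ≤ ε` and `p ≥ 0` bound it above by `-(w k w)`, an element of `K`.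
  -- Heredity of `K` finishes.
  set f : ℝ → ℝ := fun t => √(max 0 (t - ε)) with hf
  have hfc : Continuous f := by fun_prop
  have hf0 : f 0 = 0 := by simp [hf, hε.le]
  set w := cfcₙ f a with hw
  have hwsa : star w = w := (cfcₙ_predicate f a : IsSelfAdjoint w).star_eq
  have hid : cfcₙ (fun t : ℝ => t) a = a := cfcₙ_id' ℝ a
  have e1 : cfcₙ (fun t => f t * t * f t) a = w * a * w := by
    rw [cfcₙ_mul (fun t => f t * t) f a (by fun_prop) (by simp) (by fun_prop) hf0,
      cfcₙ_mul f (fun t => t) a (by fun_prop) hf0 (by fun_prop) rfl, hid]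
  have e2 : cfcₙ (fun t => ε * (f t * f t)) a = ε • (w * w) := by
    rw [cfcₙ_const_mul ε (fun t => f t * f t) a (by fun_prop) (by simp [hf0]),
      cfcₙ_mul f f a (by fun_prop) hf0 (by fun_prop) hf0]
  have hcc : cfcₙ (fun t => f t * t * f t - ε * (f t * f t)) a =
      (cutDown ⟨a, ha⟩ ε : A) * cutDown ⟨a, ha⟩ ε := by
    rw [coe_cutDown, ← cfcₙ_mul (fun t : ℝ => max 0 (t - ε)) (fun t : ℝ => max 0 (t - ε)) a
      (by fun_prop) (by simp [hε.le]) (by fun_prop) (by simp [hε.le])]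
    congr 1
    funext t
    have hs : f t * f t = max 0 (t - ε) := Real.mul_self_sqrt (le_max_left _ _)
    have : f t * t * f t - ε * (f t * f t) = (f t * f t) * (t - ε) := by ring
    rw [this, hs]
    rcases max_cases 0 (t - ε) with h | h <;> rw [h.1]
    ring
  have hcc' : w * a * w - ε • (w * w) = (cutDown ⟨a, ha⟩ ε : A) * cutDown ⟨a, ha⟩ ε := by
    rw [← hcc, cfcₙ_sub (fun t => f t * t * f t) (fun t => ε * (f t * f t)) a
      (by fun_prop) (by simp) (by fun_prop) (by simp [hf0]), e1, e2]
  have hsa : star (cutDown ⟨a, ha⟩ ε : A) = cutDown ⟨a, ha⟩ ε :=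
    (IsSelfAdjoint.of_nonneg (cutDown ⟨a, ha⟩ ε).2).star_eq
  have hwr : w * r * w ≤ ε • (w * w) := by
    have h1 := CStarAlgebra.star_left_conjugate_le_norm_smul (a := w) (b := r) hrsa
    rw [hwsa] at h1
    refine h1.trans ?_
    have h0 : 0 ≤ w * w := by nth_rw 1 [← hwsa]; exact star_mul_self_nonneg w
    gcongr
  have hwp : 0 ≤ w * p * w := by
    have := star_left_conjugate_nonneg hp w
    rwa [hwsa] at this
  have hle : w * a * w - ε • (w * w) ≤ -(w * k * w) := by
    have : -(w * k * w) - (w * a * w - ε • (w * w)) =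
        (ε • (w * w) - w * r * w) + w * p * w := by rw [hr]; noncomm_ring
    rw [← sub_nonneg, this]
    exact add_nonneg (sub_nonneg.mpr hwr) hwp
  have hmem : -(w * k * w) ∈ K := neg_mem (K.mul_mem_right _ (K.mul_mem_left _ hk))
  rw [hcc'] at hle
  rw [← K.star_mul_self_mem_iff, hsa]
  refine K.mem_of_nonneg_of_le ?_ hle hmem
  nth_rw 1 [← hsa]
  exact star_mul_self_nonneg _

end States

/-! ### States of unital C⋆-algebras that vanish on an ideal -/

section UnitalStates

open scoped ComplexOrder

variable {B : Type u} [CStarAlgebra B] [PartialOrder B] [StarOrderedRing B]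

/-- The states of a unital C⋆-algebra vanishing on a closed ideal. -/
def ClosedIdeal.states (K : ClosedIdeal B) : Set (B → ℂ) :=
  {φ | (∀ x y, φ (x + y) = φ x + φ y) ∧ (∀ (c : ℂ) x, φ (c • x) = c * φ x) ∧
    (∀ x, 0 ≤ x → 0 ≤ φ x) ∧ φ 1 = 1 ∧ ∀ k ∈ K, φ k = 0}

/-- A state as a positive linear map. -/
noncomputable def ClosedIdeal.stateMap {K : ClosedIdeal B} {φ : B → ℂ} (hφ : φ ∈ K.states) :
    B →ₚ[ℂ] ℂ :=
  PositiveLinearMap.mk₀ { toFun := φ, map_add' := hφ.1, map_smul' := hφ.2.1 } hφ.2.2.1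

/-- Hahn–Banach separates `-a` from the closed cone generated by the positive elements and the
self-adjoint part of `K`. The separating functional is nonnegative on that cone, hence zero on
self-adjoint elements of `K`, and positive at `a`; its hermitian part, normalized at 1 and extended
complex linearly, is the state. -/
theorem ClosedIdeal.exists_state (K : ClosedIdeal B) {a : B} (ha : 0 ≤ a) (haK : a ∉ K) :
    ∃ φ ∈ K.states, φ a ≠ 0 := by
  set C : Set B := {x : B | ∃ p, 0 ≤ p ∧ ∃ k ∈ K, IsSelfAdjoint k ∧ x = p + k} with hC
  have hconv : Convex ℝ C := by
    rintro _ ⟨p, hp, k, hk, hks, rfl⟩ _ ⟨q, hq, l, hl, hls, rfl⟩ s t hs ht -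
    refine ⟨s • p + t • q, add_nonneg (smul_nonneg hs hp) (smul_nonneg ht hq), s • k + t • l,
      add_mem (K.real_smul_mem s hk) (K.real_smul_mem t hl),
      ((IsSelfAdjoint.all s).smul hks).add ((IsSelfAdjoint.all t).smul hls), ?_⟩
    rw [smul_add, smul_add]; abel
  obtain ⟨f, u, hfa, hfu⟩ := geometric_hahn_banach_point_closed hconv.closure isClosed_closure
    (K.neg_notMem_closure ha haK)
  have hpos : ∀ p k, 0 ≤ p → k ∈ K → IsSelfAdjoint k → u < f (p + k) := fun p k hp hk hks =>
    hfu _ (subset_closure ⟨p, hp, k, hk, hks, rfl⟩)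
  have hu : u < 0 := by simpa using hpos 0 0 le_rfl (zero_mem K) (.zero _)
  -- A lower bound on a cone must be 0: a negative value could be rescaled by the factor `u / f (p +
  -- k)` to equal the strict lower bound `u`.
  have hnn : ∀ p k, 0 ≤ p → k ∈ K → IsSelfAdjoint k → 0 ≤ f (p + k) := by
    intro p k hp hk hks
    by_contra! hlt
    have hc : 0 ≤ u / f (p + k) := div_nonneg_of_nonpos hu.le hlt.le
    have := hpos ((u / f (p + k)) • p) ((u / f (p + k)) • k) (smul_nonneg hc hp)
      (K.real_smul_mem _ hk) ((IsSelfAdjoint.all _).smul hks)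
    rw [← smul_add, map_smul, smul_eq_mul, div_mul_cancel₀ _ hlt.ne] at this
    exact lt_irrefl _ this
  have hfp : ∀ p, 0 ≤ p → 0 ≤ f p := fun p hp => by
    simpa using hnn p 0 hp (zero_mem K) (.zero _)
  have hfk : ∀ k ∈ K, IsSelfAdjoint k → f k = 0 := by
    intro k hk hks
    refine le_antisymm ?_ (by simpa using hnn 0 k le_rfl hk hks)
    simpa using hnn 0 (-k) le_rfl (neg_mem hk) hks.neg
  have hfa0 : 0 < f a := by
    rw [map_neg] at hfa; linarith
  have hf1 : 0 < f 1 := by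
    have h1 : a ≤ ‖a‖ • (1 : B) := by
      rw [← Algebra.algebraMap_eq_smul_one]
      exact IsSelfAdjoint.le_algebraMap_norm_self (.of_nonneg ha)
    have h2 := hfp _ (sub_nonneg.mpr h1)
    rw [map_sub, map_smul, smul_eq_mul] at h2
    by_contra! h3
    nlinarith [norm_nonneg a]
  -- symmetrize and normalize
  let g : Module.Dual ℝ B :=
    { toFun := fun x => (f x + f (star x)) / (2 * f 1)
      map_add' := fun x y => by rw [star_add, map_add, map_add]; ring
      map_smul' := fun c x => by
        rw [star_smul, star_trivial, map_smul, map_smul, smul_eq_mul, smul_eq_mul, RingHom.id_apply,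
          smul_eq_mul]
        ring }
  have hg : ∀ x, g x = (f x + f (star x)) / (2 * f 1) := fun _ => rfl
  have hgsa : ∀ x, IsSelfAdjoint x → g x = f x / f 1 := fun x hx => by
    rw [hg, hx.star_eq]; field_simp; ring
  have hgI : ∀ x, IsSelfAdjoint x → g (Complex.I • x) = 0 := fun x hx => by
    rw [hg, star_smul, hx.star_eq, ← map_add, ← add_smul]
    simp
  have hφsa : ∀ x, IsSelfAdjoint x → (g.extendRCLike (𝕜 := ℂ)) x = ((f x / f 1 : ℝ) : ℂ) := by
    intro x hx
    rw [Module.Dual.extendRCLike_apply]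
    have : g ((RCLike.I : ℂ) • x) = 0 := hgI x hx
    rw [this, hgsa x hx]
    simp
  refine ⟨fun x => (g.extendRCLike (𝕜 := ℂ)) x, ⟨map_add _, map_smul _, fun x hx => ?_, ?_,
    fun k hk => ?_⟩, ?_⟩
  · beta_reduce
    rw [hφsa x (.of_nonneg hx)]
    exact_mod_cast div_nonneg (hfp x hx) hf1.le
  · beta_reduce
    rw [hφsa 1 (.one _), div_self hf1.ne']; simp
  · have hgk : ∀ k ∈ K, g k = 0 := fun k hk => by
      rw [hg, ← map_add, hfk _ (add_mem hk (star_mem hk)) (IsSelfAdjoint.add_star_self k), zero_div]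
    beta_reduce
    rw [Module.Dual.extendRCLike_apply, hgk k hk, hgk _ (SMulMemClass.smul_mem _ hk)]
    simp
  · beta_reduce
    rw [hφsa a (.of_nonneg ha)]
    exact_mod_cast (div_pos hfa0 hf1).ne'

theorem ClosedIdeal.convex_states (K : ClosedIdeal B) : Convex ℝ K.states := by
  rintro φ ⟨h1, h2, h3, h4, h5⟩ ψ ⟨g1, g2, g3, g4, g5⟩ s t hs ht hst
  refine ⟨fun x y => ?_, fun c x => ?_, fun x hx => ?_, ?_, fun k hk => ?_⟩ <;>
    simp only [Pi.add_apply, Pi.smul_apply, Complex.real_smul]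
  · rw [h1, g1]; ring
  · rw [h2, g2]; ring
  · exact add_nonneg (mul_nonneg (by exact_mod_cast hs) (h3 x hx))
      (mul_nonneg (by exact_mod_cast ht) (g3 x hx))
  · rw [h4, g4]; exact_mod_cast by linarith
  · rw [h5 k hk, g5 k hk]; simp

/-- Tychonoff: the defining conditions are closed for pointwise convergence, and `x` is a
combination of four positive elements of norm at most `‖x‖`, on each of which a state is bounded by
the norm. This gives the radius `4 * ‖x‖` without proving that states have norm one. -/
theorem ClosedIdeal.isCompact_states (K : ClosedIdeal B) : IsCompact K.states := by
  have hb : K.states ⊆ Set.univ.pi fun x : B => Metric.closedBall (0 : ℂ) (4 * ‖x‖) := by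
    intro φ hφ x _
    rw [mem_closedBall_zero_iff]
    obtain ⟨y, hy0, hyn, hy⟩ := CStarAlgebra.exists_sum_four_nonneg x
    have h1 : stateMap hφ 1 = 1 := hφ.2.2.2.1
    have h2 : ‖stateMap hφ x‖ ≤ ∑ i : Fin 4, ‖x‖ := by
      nth_rw 1 [hy]
      rw [map_sum]
      refine norm_sum_le_of_le _ fun i _ => ?_
      rw [map_smul, norm_smul, norm_pow, Complex.norm_I, one_pow, one_mul]
      have := (stateMap hφ).norm_apply_le_of_nonneg (y i) (hy0 i)
      rw [h1, norm_one, one_mul] at this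
      exact this.trans (hyn i)
    have h3 : stateMap hφ x = φ x := rfl
    rw [← h3]
    simpa using h2
  refine (isCompact_univ_pi fun x => isCompact_closedBall _ _).of_isClosed_subset ?_ hb
  have : K.states = (⋂ (x : B) (y : B), {φ : B → ℂ | φ (x + y) = φ x + φ y}) ∩
      ((⋂ (c : ℂ) (x : B), {φ : B → ℂ | φ (c • x) = c * φ x}) ∩
      ((⋂ (x : B) (_ : 0 ≤ x), {φ : B → ℂ | 0 ≤ φ x}) ∩ ({φ : B → ℂ | φ 1 = 1} ∩
      ⋂ k ∈ K, {φ : B → ℂ | φ k = 0}))) := by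
    ext φ
    simp [states]
  rw [this]
  refine (isClosed_iInter fun x => isClosed_iInter fun y => isClosed_eq (by fun_prop)
    (by fun_prop)).inter ((isClosed_iInter fun c => isClosed_iInter fun x => isClosed_eq
    (by fun_prop) (by fun_prop)).inter ((isClosed_iInter fun x => isClosed_iInter fun _ =>
    isClosed_le (by fun_prop) (by fun_prop)).inter ((isClosed_eq (by fun_prop)
    (by fun_prop)).inter (isClosed_iInter fun k => isClosed_iInter fun _ => isClosed_eq
    (by fun_prop) (by fun_prop)))))

/-- Krein–Milman: if all extreme states vanished at `a`, so would their closed convex hull, which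
contains every state vanishing on `K`. -/
theorem ClosedIdeal.exists_extreme_state (K : ClosedIdeal B) {a : B} (ha : 0 ≤ a) (haK : a ∉ K) :
    ∃ φ ∈ K.states.extremePoints ℝ, φ a ≠ 0 := by
  by_contra! hcon
  obtain ⟨φ, hφ, hne⟩ := K.exists_state ha haK
  rw [← closure_convexHull_extremePoints K.isCompact_states K.convex_states] at hφ
  have hcl : IsClosed {ψ : B → ℂ | ψ a = 0} := isClosed_eq (by fun_prop) (by fun_prop)
  have hcv : Convex ℝ {ψ : B → ℂ | ψ a = 0} := by
    intro ψ hψ χ hχ s t _ _ _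
    simp only [Set.mem_ofPred_eq] at hψ hχ ⊢
    simp [hψ, hχ]
  exact hne (closure_minimal (convexHull_min (fun ψ hψ => hcon ψ hψ) hcv) hcl hφ)

end UnitalStates


/-! ### Irreducibility of the GNS representation of a pure state -/

section GNS

open scoped ComplexOrder InnerProductSpace

variable {B : Type u} [CStarAlgebra B] [PartialOrder B] [StarOrderedRing B]

theorem inner_rep_left {H : Type*} [NormedAddCommGroup H] [InnerProductSpace ℂ H]
    [CompleteSpace H] (π : B →⋆ₙₐ[ℂ] (H →L[ℂ] H)) (b : B) (x y : H) :
    ⟪π (star b) x, y⟫_ℂ = ⟪x, π b y⟫_ℂ := by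
  rw [map_star, ContinuousLinearMap.star_eq_adjoint, ContinuousLinearMap.adjoint_inner_left]

/-- A cyclic representation inducing an extreme point of the set of states vanishing on `K` kills
`K` and has no nontrivial closed invariant subspaces. -/
theorem ClosedIdeal.rep_irreducible_of_extreme {H : Type*} [NormedAddCommGroup H]
    [InnerProductSpace ℂ H] [CompleteSpace H] {K : ClosedIdeal B} {φ : B → ℂ}
    (hφ : φ ∈ K.states.extremePoints ℝ) (π : B →⋆ₙₐ[ℂ] (H →L[ℂ] H)) (ξ : H)
    (hcyc : DenseRange fun b => π b ξ) (hξφ : ∀ b, ⟪ξ, π b ξ⟫_ℂ = φ b) :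
    (∀ k ∈ K, π k = 0) ∧ ∀ N : Submodule ℂ H, IsClosed (N : Set H) →
      (∀ b, ∀ η ∈ N, π b η ∈ N) → N = ⊥ ∨ N = ⊤ := by
  -- On the dense orbit of `ξ`, `‖π k (π b ξ)‖² = φ (b⋆ k⋆ k b)`, and the argument of `φ` lies in
  -- `K`.
  have hπK : ∀ k ∈ K, π k = 0 := by
    intro k hk
    have : (π k : H → H) = fun _ => 0 := by
      refine hcyc.equalizer (by fun_prop) (by fun_prop) (funext fun b => ?_)
      rw [Function.comp_apply, Function.comp_apply, ← inner_self_eq_zero (𝕜 := ℂ)]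
      nth_rw 1 [← star_star k]
      rw [inner_rep_left]
      nth_rw 1 [← star_star b]
      rw [inner_rep_left, ← mul_apply_eq_comp, ← mul_apply_eq_comp,
        ← mul_apply_eq_comp, ← map_mul, ← map_mul, ← map_mul, hξφ]
      exact hφ.1.2.2.2.2 _
        (K.mul_mem_right _ (K.mul_mem_left _ hk))
    ext x
    exact congrFun this x
  have hπ1 : (π 1 : H → H) = fun x => x := by
    refine hcyc.equalizer (by fun_prop) (by fun_prop) (funext fun b => ?_)
    rw [Function.comp_apply, Function.comp_apply, ← mul_apply_eq_comp, ← map_mul, one_mul]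
  refine ⟨hπK, fun N hN hinv => ?_⟩
  have : CompleteSpace N := hN.completeSpace_coe
  set P := N.starProjection with hP
  -- The orthogonal complement of an invariant subspace is invariant too, because `π` preserves
  -- adjoints.
  have hcomm : ∀ b η, P (π b η) = π b (P η) := by
    intro b η
    refine Submodule.eq_starProjection_of_mem_orthogonal (hinv b _ (N.starProjection_apply_mem η)) ?_
    rw [← map_sub, Submodule.mem_orthogonal]
    intro x hx
    rw [← inner_rep_left]
    exact (Submodule.mem_orthogonal N _).mp (N.sub_starProjection_mem_orthogonal η) _ (hinv _ x hx)
  have hsym : ∀ x y, ⟪P x, y⟫_ℂ = ⟪x, P y⟫_ℂ := N.inner_starProjection_left_eq_right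
  have hidem : ∀ x, P (P x) = P x := fun x =>
    Submodule.starProjection_eq_self_iff.mpr (N.starProjection_apply_mem x)
  have hξ1 : ⟪ξ, ξ⟫_ℂ = 1 := by
    rw [← hφ.1.2.2.2.1, ← hξφ, congrFun hπ1 ξ]
  set c : ℝ := ‖P ξ‖ ^ 2 with hc
  have hcin : ⟪P ξ, ξ⟫_ℂ = (c : ℂ) := by
    rw [← hidem, hsym, inner_self_eq_norm_sq_to_K]
    simp [hc]
  -- if `P ξ` is a multiple of `ξ` then `N` is trivial
  have key : ∀ s : ℂ, P ξ = s • ξ → N = ⊥ ∨ N = ⊤ := by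
    intro s hs
    have hPs : (P : H → H) = fun x => s • x := by
      refine hcyc.equalizer (by fun_prop) (by fun_prop) (funext fun b => ?_)
      rw [Function.comp_apply, Function.comp_apply, hcomm, hs, map_smul]
    by_cases hs0 : s = 0
    · left
      refine (Submodule.eq_bot_iff _).mpr fun x hx => ?_
      rw [← Submodule.starProjection_eq_self_iff.mpr hx, ← hP, congrFun hPs x, hs0, zero_smul]
    · right
      refine (Submodule.eq_top_iff').mpr fun x => ?_
      have : x = s⁻¹ • P x := by rw [congrFun hPs x, inv_smul_smul₀ hs0]
      rw [this]
      exact N.smul_mem _ (N.starProjection_apply_mem x)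
  have hvec : ∀ {t : ℝ}, 0 < t → ∀ η : H, ⟪η, η⟫_ℂ = t →
      (fun b => (t : ℂ)⁻¹ * ⟪η, π b η⟫_ℂ) ∈ K.states := by
    intro t ht η hη
    refine ⟨fun x y => ?_, fun z x => ?_, fun x hx => ?_, ?_, fun k hk => ?_⟩
    · beta_reduce
      rw [map_add, add_apply, inner_add_right, mul_add]
    · beta_reduce
      rw [map_smul, smul_apply, inner_smul_right]; ring
    · obtain ⟨d, rfl⟩ := CStarAlgebra.nonneg_iff_eq_star_mul_self.mp hx
      beta_reduce
      rw [map_mul, mul_apply_eq_comp, ← inner_rep_left, star_star,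
        inner_self_eq_norm_sq_to_K, RCLike.ofReal_eq_complex_ofReal]
      have h1 : (0 : ℂ) ≤ (t : ℂ)⁻¹ := by
        rw [← Complex.ofReal_inv]; exact_mod_cast (inv_pos.mpr ht).le
      refine mul_nonneg h1 ?_
      exact_mod_cast sq_nonneg ‖π d η‖
    · beta_reduce
      rw [congrFun hπ1 η, hη]
      exact inv_mul_cancel₀ (by exact_mod_cast ht.ne')
    · beta_reduce
      rw [hπK k hk]; simp
  have hQξ : ⟪ξ - P ξ, ξ - P ξ⟫_ℂ = ((1 - c : ℝ) : ℂ) := by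
    have h1 : ⟪P ξ, P ξ⟫_ℂ = (c : ℂ) := by rw [← hsym, hidem, hcin]
    rw [inner_sub_left, inner_sub_right, inner_sub_right, ← hsym, hξ1, hcin, h1]
    push_cast; ring
  have hc0 : 0 ≤ c := sq_nonneg _
  have hc1 : 0 ≤ 1 - c := by
    have := inner_self_eq_norm_sq_to_K (𝕜 := ℂ) (ξ - P ξ)
    rw [hQξ, RCLike.ofReal_eq_complex_ofReal] at this
    have h2 : (1 - c : ℝ) = ‖ξ - P ξ‖ ^ 2 := by exact_mod_cast this
    rw [h2]; exact sq_nonneg _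
  rcases hc0.eq_or_lt with h0 | h0
  · refine key 0 ?_
    have : ‖P ξ‖ = 0 := by rw [hc] at h0; exact pow_eq_zero_iff two_ne_zero |>.mp h0.symm
    rw [norm_eq_zero.mp this, zero_smul]
  rcases hc1.eq_or_lt with h1 | h1
  · refine key 1 ?_
    rw [← h1, Complex.ofReal_zero, inner_self_eq_zero, sub_eq_zero] at hQξ
    rw [one_smul]
    exact hQξ.symm
  -- the proper case contradicts extremality unless `P ξ = c ξ`
  have hP1 : ⟪P ξ, P ξ⟫_ℂ = (c : ℂ) := by rw [← hsym, hidem, hcin]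
  have hs1 := hvec h0 (P ξ) hP1
  have hs2 := hvec h1 (ξ - P ξ) hQξ
  have hPin : ∀ b, ⟪P ξ, π b (P ξ)⟫_ℂ = ⟪P ξ, π b ξ⟫_ℂ := fun b => by
    rw [← hcomm, ← hsym, hidem]
  -- As `P` commutes with the representation, the cross terms vanish and `φ` splits into the vector
  -- functionals of `P ξ` and `ξ - P ξ`, of total masses `c` and `1 - c`.
  have hsum : φ ∈ openSegment ℝ (fun b => (c : ℂ)⁻¹ * ⟪P ξ, π b (P ξ)⟫_ℂ)
      (fun b => ((1 - c : ℝ) : ℂ)⁻¹ * ⟪ξ - P ξ, π b (ξ - P ξ)⟫_ℂ) := by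
    refine ⟨c, 1 - c, h0, h1, by ring, ?_⟩
    funext b
    simp only [Pi.add_apply, Pi.smul_apply, Complex.real_smul]
    rw [mul_inv_cancel_left₀ (by exact_mod_cast h0.ne'),
      mul_inv_cancel_left₀ (by exact_mod_cast h1.ne'), hPin, map_sub, inner_sub_left,
      inner_sub_right, inner_sub_right, hPin, ← hξφ b, ← hcomm, hsym]
    rw [← hsym]
    ring
  have hext := (mem_extremePoints.mp hφ).2 _ hs1 _ hs2 hsum
  refine key c ?_
  -- Extremality gives `⟪P ξ, π b ξ⟫ = c * φ b` for all `b`, so `P ξ - c • ξ` is orthogonal to the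
  -- dense orbit of `ξ`.
  have hort : (fun x : H => ⟪P ξ - (c : ℂ) • ξ, x⟫_ℂ) = fun _ => 0 := by
    refine hcyc.equalizer (by fun_prop) (by fun_prop) (funext fun b => ?_)
    have h2 := congrFun hext.1 b
    beta_reduce at h2
    rw [Function.comp_apply, Function.comp_apply]
    rw [hPin, ← hξφ b, inv_mul_eq_iff_eq_mul₀
      (by exact_mod_cast h0.ne')] at h2
    rw [inner_sub_left, inner_smul_left, Complex.conj_ofReal, sub_eq_zero]
    exact h2
  have := congrFun hort (P ξ - (c : ℂ) • ξ)
  exact sub_eq_zero.mp (inner_self_eq_zero.mp this)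

/-- A positive element outside a closed ideal is detected by an irreducible representation that
kills the ideal. -/
theorem ClosedIdeal.exists_rep (K : ClosedIdeal B) {a : B} (ha : 0 ≤ a) (haK : a ∉ K) :
    ∃ (H : Type u) (_ : NormedAddCommGroup H) (_ : InnerProductSpace ℂ H) (_ : CompleteSpace H)
      (π : B →⋆ₙₐ[ℂ] (H →L[ℂ] H)), (∀ k ∈ K, π k = 0) ∧ π a ≠ 0 ∧
      ∀ N : Submodule ℂ H, IsClosed (N : Set H) →
        (∀ b, ∀ η ∈ N, π b η ∈ N) → N = ⊥ ∨ N = ⊤ := by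
  obtain ⟨φ, hφ, hφa⟩ := K.exists_extreme_state ha haK
  let f := stateMap hφ.1
  let ξ : f.GNS := ((f.toPreGNS 1 : f.PreGNS) : UniformSpace.Completion f.PreGNS)
  have horb : ∀ b, f.gnsNonUnitalStarAlgHom b ξ =
      ((f.toPreGNS b : f.PreGNS) : UniformSpace.Completion f.PreGNS) := by
    intro b
    simp only [ξ]
    rw [PositiveLinearMap.gnsNonUnitalStarAlgHom_apply_coe]
    simp
  have hcyc : DenseRange fun b => f.gnsNonUnitalStarAlgHom b ξ := by
    simp only [horb]
    exact UniformSpace.Completion.denseRange_coe.comp f.toPreGNS.surjective.denseRange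
      (UniformSpace.Completion.continuous_coe _)
  have hξφ : ∀ b, ⟪ξ, f.gnsNonUnitalStarAlgHom b ξ⟫_ℂ = φ b := by
    intro b
    rw [horb]
    simp only [ξ]
    rw [UniformSpace.Completion.inner_coe, PositiveLinearMap.preGNS_inner_def]
    simp only [PositiveLinearMap.ofPreGNS_toPreGNS, star_one, one_mul]
    rfl
  obtain ⟨h1, h2⟩ := rep_irreducible_of_extreme hφ f.gnsNonUnitalStarAlgHom ξ hcyc hξφ
  refine ⟨f.GNS, inferInstance, inferInstance, inferInstance, f.gnsNonUnitalStarAlgHom, h1,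
    fun h0 => hφa ?_, h2⟩
  rw [← hξφ, h0]
  simp

end GNS


/-! ### Existence of primitive ideals -/

section Primitive

open scoped CStarAlgebra

variable {A : Type u} [NonUnitalCStarAlgebra A]

/-- A closed ideal, regarded as a closed ideal of the unitization. -/
noncomputable def ClosedIdeal.unitization (K : ClosedIdeal A) : ClosedIdeal (Unitization ℂ A) where
  toSubmodule := K.toSubmodule.map (Unitization.inrHom ℂ ℂ A)
  mul_mem_left' := by
    rintro x _ ⟨k, hk, rfl⟩
    refine ⟨x.fst • k + x.snd * k,
      add_mem (SMulMemClass.smul_mem _ hk) (K.mul_mem_left _ hk), ?_⟩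
    refine Unitization.ext ?_ ?_ <;> simp
  mul_mem_right' := by
    rintro x _ ⟨k, hk, rfl⟩
    refine ⟨x.fst • k + k * x.snd,
      add_mem (SMulMemClass.smul_mem _ hk) (K.mul_mem_right _ hk), ?_⟩
    refine Unitization.ext ?_ ?_ <;> simp
  isClosed' := (Unitization.isometry_inr (𝕜 := ℂ) (A := A)).isClosedEmbedding.isClosedMap _
    K.isClosed

theorem ClosedIdeal.inr_mem_unitization {K : ClosedIdeal A} {a : A} :
    (a : Unitization ℂ A) ∈ K.unitization ↔ a ∈ K := by
  constructor
  · rintro ⟨k, hk, h⟩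
    rwa [← Unitization.inr_injective h]
  · exact fun h => ⟨a, h, rfl⟩

/-- The kernel of a representation. -/
def ClosedIdeal.ker {H : Type*} [NormedAddCommGroup H] [InnerProductSpace ℂ H]
    [CompleteSpace H] (π : A →⋆ₙₐ[ℂ] (H →L[ℂ] H)) : ClosedIdeal A where
  carrier := {a | π a = 0}
  add_mem' {a b} ha hb := by
    simp only [Set.mem_ofPred_eq] at *
    rw [map_add, ha, hb, add_zero]
  zero_mem' := map_zero π
  smul_mem' c a ha := by
    simp only [Set.mem_ofPred_eq] at *
    rw [map_smul, ha, smul_zero]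
  mul_mem_left' x a ha := by
    simp only [Set.mem_ofPred_eq] at *
    rw [map_mul, ha, mul_zero]
  mul_mem_right' x a ha := by
    simp only [Set.mem_ofPred_eq] at *
    rw [map_mul, ha, zero_mul]
  isClosed' := isClosed_eq (map_continuous π) continuous_const

/-- Restricting an irreducible representation of the unitization. -/
theorem isIrreducibleRep_comp_inr {H : Type u} [NormedAddCommGroup H] [InnerProductSpace ℂ H]
    [CompleteSpace H] (π : Unitization ℂ A →⋆ₙₐ[ℂ] (H →L[ℂ] H))
    (hπ : ∀ N : Submodule ℂ H, IsClosed (N : Set H) → (∀ b, ∀ η ∈ N, π b η ∈ N) → N = ⊥ ∨ N = ⊤)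
    {a : A} (ha : π a ≠ 0) :
    IsIrreducibleRep (π.comp (Unitization.inrNonUnitalStarAlgHom ℂ A)) := by
  have happ : ∀ x : A, π.comp (Unitization.inrNonUnitalStarAlgHom ℂ A) x = π x := fun _ => rfl
  refine ⟨⟨a, ha⟩, fun N hN hinv => ?_⟩
  simp only [happ] at hinv
  have hmulr : ∀ (x : A) (b : Unitization ℂ A), ∃ y : A, (x : Unitization ℂ A) * b = y :=
    fun x b => ⟨b.fst • x + x * b.snd, by refine Unitization.ext ?_ ?_ <;> simp⟩
  have hmull : ∀ (x : A) (b : Unitization ℂ A), ∃ y : A, b * (x : Unitization ℂ A) = y :=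
    fun x b => ⟨b.fst • x + b.snd * x, by refine Unitization.ext ?_ ?_ <;> simp⟩
  -- the common kernel of `π(A)` is trivial
  let Z : Submodule ℂ H := ⨅ x : A, (π x).ker
  have hZ : ∀ η, η ∈ Z ↔ ∀ x : A, π x η = 0 := fun η => by simp [Z]
  have hZc : IsClosed (Z : Set H) := by
    have : (Z : Set H) = ⋂ x : A, {η | π x η = 0} := by ext η; simp [hZ]
    rw [this]
    exact isClosed_iInter fun x => isClosed_eq (by fun_prop) (by fun_prop)
  have hZbot : Z = ⊥ := by
    refine (hπ Z hZc fun b η hη => (hZ _).mpr fun x => ?_).resolve_right fun htop => ha ?_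
    · obtain ⟨y, hy⟩ := hmulr x b
      rw [← mul_apply_eq_comp, ← map_mul, hy]
      exact (hZ η).mp hη y
    · ext η
      exact (hZ η).mp (htop ▸ Submodule.mem_top) a
  -- the closed span of `π(A) N`
  let S : Submodule ℂ H := Submodule.span ℂ {ζ | ∃ x : A, ∃ η ∈ N, ζ = π x η}
  have hSN : S.topologicalClosure ≤ N := by
    refine S.topologicalClosure_minimal (Submodule.span_le.mpr ?_) hN
    rintro _ ⟨x, η, hη, rfl⟩
    exact hinv x η hη
  have hSinv : ∀ b, ∀ ζ ∈ S.topologicalClosure, π b ζ ∈ S.topologicalClosure := by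
    intro b ζ hζ
    refine map_mem_closure (f := π b) (by fun_prop) hζ fun ζ hζ => ?_
    induction hζ using Submodule.span_induction with
    | mem ζ h =>
      obtain ⟨x, η, hη, rfl⟩ := h
      obtain ⟨y, hy⟩ := hmull x b
      rw [← mul_apply_eq_comp, ← map_mul, hy]
      exact Submodule.subset_span ⟨y, η, hη, rfl⟩
    | zero => rw [map_zero]; exact S.zero_mem
    | add ζ θ _ _ h1 h2 => rw [map_add]; exact S.add_mem h1 h2
    | smul c ζ _ h => rw [map_smul]; exact S.smul_mem c h
  -- Unlike `N`, the closed span of `π(A) N` is known to be invariant under the whole unitization,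
  -- so it is zero or everything. If zero, `N` lies in the common kernel `Z = ⊥`; otherwise `N`,
  -- which contains it, is everything.
  rcases hπ _ S.isClosed_topologicalClosure hSinv with h | h
  · left
    refine (Submodule.eq_bot_iff N).mpr fun η hη => ?_
    have : η ∈ Z := (hZ η).mpr fun x => by
      have hx : π x η ∈ S.topologicalClosure :=
        S.le_topologicalClosure (Submodule.subset_span ⟨x, η, hη, rfl⟩)
      rwa [h, Submodule.mem_bot] at hx
    rwa [hZbot, Submodule.mem_bot] at this
  · right
    exact top_le_iff.mp (h ▸ hSN)

/-- A closed ideal is an intersection of primitive ideals. -/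
theorem ClosedIdeal.exists_primitive (K : ClosedIdeal A) {a : A} (ha : a ∉ K) :
    ∃ P : Prim A, K ≤ P.1 ∧ a ∉ P.1 := by
  let _ := CStarAlgebra.spectralOrder A
  let _ := CStarAlgebra.spectralOrderedRing A
  have h1 : ((star a * a : A) : Unitization ℂ A) ∉ K.unitization := by
    rwa [inr_mem_unitization, K.star_mul_self_mem_iff]
  obtain ⟨H, i1, i2, i3, π, hπK, hπa, hπ⟩ := K.unitization.exists_rep
    (Unitization.inr_nonneg_iff.mpr (star_mul_self_nonneg a)) h1
  refine ⟨⟨ker (π.comp (Unitization.inrNonUnitalStarAlgHom ℂ A)), H, i1, i2, i3, _,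
    isIrreducibleRep_comp_inr π hπ hπa, fun _ => Iff.rfl⟩, fun k hk => ?_, fun h => hπa ?_⟩
  · exact hπK _ (inr_mem_unitization.mpr hk)
  · have : π a = 0 := h
    rw [Unitization.inr_mul, map_mul, this, mul_zero]

theorem ClosedIdeal.eq_top_of_forall_not_le (K : ClosedIdeal A) (h : ∀ P : Prim A, ¬ K ≤ P.1) :
    K = ⊤ := by
  refine top_le_iff.mp fun a _ => ?_
  by_contra ha
  obtain ⟨P, hP, -⟩ := K.exists_primitive ha
  exact h P hP

theorem Prim.exists_notMem (P : Prim A) : ∃ a, a ∉ P.1 := by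
  obtain ⟨_, _, _, _, _, π, ⟨⟨a, ha⟩, _⟩, hker⟩ := P
  exact ⟨a, fun h => ha ((hker a).mp h)⟩

end Primitive


/-! ### Compactness of the primitive ideal space -/

section Compactness

variable {A : Type u} [NonUnitalCStarAlgebra A]

/-- The intersection of a closed ideal of `A` with `I`, as a closed ideal of `I`. -/
def ClosedIdeal.comap (I J : ClosedIdeal A) : ClosedIdeal I where
  carrier := {x | (x : A) ∈ J}
  add_mem' ha hb := add_mem (S := ClosedIdeal A) ha hb
  zero_mem' := zero_mem J
  smul_mem' _ _ ha := SMulMemClass.smul_mem (S := ClosedIdeal A) _ ha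
  mul_mem_left' _ _ ha := J.mul_mem_left _ ha
  mul_mem_right' _ _ ha := J.mul_mem_right _ ha
  isClosed' := J.isClosed.preimage continuous_subtype_val

theorem ClosedIdeal.mem_comap {I J : ClosedIdeal A} {x : I} : x ∈ I.comap J ↔ (x : A) ∈ J := Iff.rfl

/-- An ideal of an ideal is an ideal: `L` is spanned by elements `c⋆c` with `c ∈ L`, and in `x c⋆c`
the factor `x c⋆` lies in `I`, so the product is in `L`; the other side is symmetric. -/
theorem ClosedIdeal.mul_mem_of_mem (I : ClosedIdeal A) (L : ClosedIdeal I) (x : A) (l : L) :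
    (∃ y ∈ L, (y : A) = x * ((l : I) : A)) ∧ ∃ y ∈ L, (y : A) = ((l : I) : A) * x := by
  have hl : l ∈ Submodule.span ℂ {a : L | ∃ c, a = star c * c} := by
    rw [span_star_mul_self]; exact Submodule.mem_top
  induction hl using Submodule.span_induction with
  | mem l h =>
    obtain ⟨c, rfl⟩ := h
    exact ⟨⟨⟨x * star ((c : I) : A), I.mul_mem_left x (star_mem c.1.2)⟩ * (c : I),
      L.mul_mem_left _ c.2, mul_assoc x _ _⟩, ⟨(star c : L).1 * ⟨((c : I) : A) * x,
      I.mul_mem_right x c.1.2⟩, L.mul_mem_right _ (star c : L).2, (mul_assoc _ _ x).symm⟩⟩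
  | zero => exact ⟨⟨0, zero_mem L, (mul_zero x).symm⟩, ⟨0, zero_mem L, (zero_mul x).symm⟩⟩
  | add a b _ _ ha hb =>
    obtain ⟨⟨y, hy, hya⟩, ⟨y', hy', hya'⟩⟩ := ha
    obtain ⟨⟨z, hz, hzb⟩, ⟨z', hz', hzb'⟩⟩ := hb
    refine ⟨⟨y + z, add_mem hy hz, ?_⟩, ⟨y' + z', add_mem hy' hz', ?_⟩⟩
    · exact (congrArg₂ (· + ·) hya hzb).trans (mul_add x _ _).symm
    · exact (congrArg₂ (· + ·) hya' hzb').trans (add_mul _ _ x).symm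
  | smul r a _ ha =>
    obtain ⟨⟨y, hy, hya⟩, ⟨y', hy', hya'⟩⟩ := ha
    refine ⟨⟨r • y, SMulMemClass.smul_mem r hy, ?_⟩, ⟨r • y', SMulMemClass.smul_mem r hy', ?_⟩⟩
    · exact (congrArg (r • ·) hya).trans (mul_smul_comm r x _).symm
    · exact (congrArg (r • ·) hya').trans (smul_mul_assoc r _ x).symm

/-- A closed ideal of `I` is a closed ideal of `A`. -/
def ClosedIdeal.map (I : ClosedIdeal A) (L : ClosedIdeal I) : ClosedIdeal A where
  carrier := Subtype.val '' (L : Set I)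
  add_mem' := by
    rintro _ _ ⟨a, ha, rfl⟩ ⟨b, hb, rfl⟩
    exact ⟨a + b, add_mem ha hb, rfl⟩
  zero_mem' := ⟨0, zero_mem L, rfl⟩
  smul_mem' := by
    rintro c _ ⟨a, ha, rfl⟩
    exact ⟨c • a, SMulMemClass.smul_mem c ha, rfl⟩
  mul_mem_left' := by
    rintro x _ ⟨a, ha, rfl⟩
    exact (I.mul_mem_of_mem L x ⟨a, ha⟩).1
  mul_mem_right' := by
    rintro x _ ⟨a, ha, rfl⟩
    exact (I.mul_mem_of_mem L x ⟨a, ha⟩).2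
  isClosed' := I.isClosed.isClosedEmbedding_subtypeVal.isClosedMap _ L.isClosed

/-- An element of `I` is full in `I` exactly when it generates `I` as a closed ideal of `A`. -/
theorem ClosedIdeal.isFull_iff {I : ClosedIdeal A} {e : I} :
    IsFull e ↔ ClosedIdeal.span {(e : A)} = I := by
  constructor
  · refine fun h => le_antisymm (span_singleton_le.mpr e.2) fun x hx => ?_
    have h1 : span {e} ≤ I.comap (span {(e : A)}) :=
      span_singleton_le.mpr (mem_comap.mpr (mem_span_singleton_self _))
    rw [IsFull] at h
    rw [h] at h1
    exact h1 (mem_top (⟨x, hx⟩ : I))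
  · refine fun h => top_le_iff.mp fun x _ => ?_
    have h1 : span {(e : A)} ≤ I.map (span {e}) :=
      span_singleton_le.mpr ⟨e, mem_span_singleton_self e, rfl⟩
    rw [h] at h1
    obtain ⟨y, hy, hyx⟩ := h1 x.2
    rwa [← Subtype.ext hyx]

/-- A two-sided ideal of `A` whose closure contains `I` meets `I` in a dense ideal. -/
theorem IsTwoSidedIdeal.dense_comap {U : Submodule ℂ A} (hU : IsTwoSidedIdeal U)
    {I : ClosedIdeal A} (hI : I ≤ hU.closure) :
    ∃ V : Submodule ℂ I, IsTwoSidedIdeal V ∧ Dense (V : Set I) ∧ ∀ x : I, x ∈ V ↔ (x : A) ∈ U := by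
  let V : Submodule ℂ I :=
    { carrier := {x | (x : A) ∈ U}
      add_mem' := fun ha hb => U.add_mem ha hb
      zero_mem' := U.zero_mem
      smul_mem' := fun c _ ha => U.smul_mem c ha }
  have hV : IsTwoSidedIdeal V := fun x a ha => hU x a ha
  refine ⟨V, hV, fun x => ?_, fun x => Iff.rfl⟩
  have hx : x ∈ Submodule.span ℂ {a : I | ∃ c, a = star c * c} := by
    rw [span_star_mul_self]; exact Submodule.mem_top
  refine (Submodule.span_le.mpr ?_ : _ ≤ V.topologicalClosure) hx
  rintro _ ⟨c, rfl⟩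
  rw [SetLike.mem_coe, ← SetLike.mem_coe, Submodule.topologicalClosure_coe, Metric.mem_closure_iff]
  intro ε hε
  -- An approximant `y ∈ U` of `c` need not lie in `I`, but `c⋆y` does, and it approximates `c⋆c`.
  -- This is why the density is checked on the elements `c⋆c`.
  have hc : (c : A) ∈ _root_.closure (U : Set A) := hI c.2
  have h2 : star (c : A) * c ∈ _root_.closure ((fun y => star (c : A) * y) '' (U : Set A)) :=
    map_mem_closure (continuous_const_mul _) hc fun y hy => ⟨y, hy, rfl⟩
  obtain ⟨_, ⟨y, hy, rfl⟩, hd⟩ := Metric.mem_closure_iff.mp h2 ε hε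
  exact ⟨⟨star (c : A) * y, I.mul_mem_right y (star_mem c.2)⟩, (hU _ y hy).1, hd⟩

/-- The union of a directed family whose supremum contains `I` restricts to a dense ideal of `I`, so
it contains the Pedersen element `e`. One member then contains `e`, hence all of `I`. -/
theorem ClosedIdeal.isCompactElement_of_isFull {I : ClosedIdeal A} {e : I}
    (he : e ∈ pedersenIdeal I) (hf : IsFull e) : IsCompactElement I := by
  rw [CompleteLattice.isCompactElement_iff_le_of_directed_sSup_le]
  intro D hne hD hle
  obtain ⟨U, hU, hmem, heq⟩ := exists_sSup_eq_closure hne hD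
  obtain ⟨V, hV, hdense, hVU⟩ := hU.dense_comap (heq ▸ hle)
  obtain ⟨J, hJ, heJ⟩ := (hmem _).mp ((hVU e).mp (hV.pedersenIdeal_le hdense he))
  refine ⟨J, hJ, ?_⟩
  rw [← isFull_iff.mp hf]
  exact span_singleton_le.mpr heJ

/-- The same argument inside a single algebra; it will be applied to `I` as an algebra, since
`Prim(I)` sees the ideal lattice of `I` rather than that of `A`. -/
theorem isCompactElement_top_of_isFull {e : A} (he : e ∈ pedersenIdeal A) (hf : IsFull e) :
    IsCompactElement (⊤ : ClosedIdeal A) := by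
  rw [CompleteLattice.isCompactElement_iff_le_of_directed_sSup_le]
  intro D hne hD hle
  obtain ⟨U, hU, hmem, heq⟩ := ClosedIdeal.exists_sSup_eq_closure hne hD
  rw [heq] at hle
  have hd : Dense (U : Set A) := fun x => hle (ClosedIdeal.mem_top x)
  obtain ⟨J, hJ, heJ⟩ := (hmem e).mp (hU.pedersenIdeal_le hd he)
  refine ⟨J, hJ, ?_⟩
  rw [← hf]
  exact ClosedIdeal.span_singleton_le.mpr heJ

/-- By Alexander's subbase theorem only covers by complements of hulls matter. Such a cover means
that no primitive ideal contains all the ideals involved, that is, that their supremum is the whole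
algebra; compactness of `⊤` selects finitely many of them. -/
theorem compactSpace_prim_of_isCompactElement_top (h : IsCompactElement (⊤ : ClosedIdeal A)) :
    CompactSpace (Prim A) := by
  classical
  refine compactSpace_generateFrom rfl fun 𝒰 h𝒰 hcov => ?_
  set 𝒦 : Set (ClosedIdeal A) := {K | {P : Prim A | K ≤ P.1}ᶜ ∈ 𝒰} with h𝒦
  have hsup : sSup 𝒦 = ⊤ := by
    refine ClosedIdeal.eq_top_of_forall_not_le _ fun P hP => ?_
    obtain ⟨V, hV, hPV⟩ : P ∈ ⋃₀ 𝒰 := hcov ▸ Set.mem_univ P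
    obtain ⟨K, rfl⟩ := h𝒰 hV
    exact hPV ((le_sSup (show K ∈ 𝒦 from hV)).trans hP)
  obtain ⟨t, ht, htop⟩ :=
    (CompleteLattice.isCompactElement_iff_exists_le_sSup_of_le_sSup _ _).mp h 𝒦 hsup.ge
  refine ⟨(fun K : ClosedIdeal A => {P : Prim A | K ≤ P.1}ᶜ) '' t, ?_, t.finite_toSet.image _,
    Set.eq_univ_of_forall fun P => ?_⟩
  · rintro _ ⟨K, hK, rfl⟩
    exact ht hK
  · by_contra hcon
    have hle : t.sup id ≤ P.1 := Finset.sup_le fun K hK => by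
      by_contra hKP
      exact hcon ⟨_, ⟨K, hK, rfl⟩, hKP⟩
    obtain ⟨a, ha⟩ := P.exists_notMem
    exact ha (hle (htop (ClosedIdeal.mem_top a)))

open Trace in
/-- If the primitive ideal space is compact, the Pedersen ideal contains a full positive element. -/
theorem exists_isFull_of_compactSpace_prim [CompactSpace (Prim A)] :
    ∃ c : A, star c * c ∈ pedersenIdeal A ∧ IsFull (star c * c) := by
  let _ := CStarAlgebra.spectralOrder A
  let _ := CStarAlgebra.spectralOrderedRing A
  -- The open sets of those `P` not containing a given cut-down cover `Prim A`, as each `P` is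
  -- proper. The sum of the cut-downs in a finite subcover lies in the Pedersen ideal and, by
  -- heredity of ideals, in no primitive ideal, so it is full.
  let U : Pos A × {ε : ℝ // 0 < ε} → Set (Prim A) := fun p =>
    {P : Prim A | ClosedIdeal.span {(cutDown p.1 p.2 : A)} ≤ P.1}ᶜ
  have hU : ∀ p P, P ∈ U p ↔ (cutDown p.1 p.2 : A) ∉ P.1 := fun p P =>
    not_congr ClosedIdeal.span_singleton_le
  have hUo : ∀ p, IsOpen (U p) := fun p => TopologicalSpace.isOpen_generateFrom_of_mem ⟨_, rfl⟩
  obtain ⟨t, ht⟩ := isCompact_univ.elim_finite_subcover U hUo fun P _ => by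
      obtain ⟨a, ha⟩ := P.exists_notMem
      rw [← P.1.star_mul_self_mem_iff] at ha
      have := mt (mem_of_forall_cutDown_mem P.1 (a := ⟨star a * a, star_mul_self_nonneg a⟩)) ha
      push Not at this
      obtain ⟨ε, hε, h⟩ := this
      exact Set.mem_iUnion.mpr ⟨(_, ⟨ε, hε⟩), (hU _ _).mpr h⟩
  set e : A := ∑ p ∈ t, (cutDown p.1 p.2 : A) with he
  have he0 : 0 ≤ e := Finset.sum_nonneg fun p _ => (cutDown p.1 p.2).2
  obtain ⟨c, hc⟩ := CStarAlgebra.nonneg_iff_eq_star_mul_self.mp he0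
  refine ⟨c, hc ▸ Submodule.sum_mem _ fun p _ => ?_, hc ▸ ?_⟩
  · exact mem_pedersenIdeal_of_mul_eq_self (plateau_mul_cutDown p.1 p.2.2)
  · refine ClosedIdeal.eq_top_of_forall_not_le _ fun P hP => ?_
    have heP := ClosedIdeal.span_singleton_le.mp hP
    obtain ⟨p, hp, hpP⟩ := Set.mem_iUnion₂.mp (ht (Set.mem_univ P))
    refine (hU p P).mp hpP (P.1.mem_of_nonneg_of_le (cutDown p.1 p.2).2 ?_ heP)
    exact Finset.single_le_sum (f := fun p : Pos A × {ε : ℝ // 0 < ε} => (cutDown p.1 p.2 : A))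
      (fun p _ => (cutDown p.1 p.2).2) hp

/-! ### Positive generators of compact ideals -/

section Order

variable [PartialOrder A] [StarOrderedRing A]

open Trace in
/-- If `I` is a compact element of the lattice of closed ideals, every positive generator remains a
generator after being slightly cut down. -/
theorem ClosedIdeal.exists_span_cutDown_eq {I : ClosedIdeal A} (hI : IsCompactElement I)
    {b : Pos A} (hb : span {(b : A)} = I) :
    ∃ ε, 0 < ε ∧ span {(cutDown b ε : A)} = I := by
  rw [CompleteLattice.isCompactElement_iff_le_of_directed_sSup_le] at hI
  have hanti : ∀ {s t : ℝ}, 0 < s → s ≤ t →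
      span {(cutDown b t : A)} ≤ span {(cutDown b s : A)} := fun hs hst =>
    span_singleton_le.mpr (mem_of_nonneg_of_le _ (cutDown b _).2 (cutDown_le b hs.le hst)
      (mem_span_singleton_self _))
  set D : Set (ClosedIdeal A) := {J | ∃ ε, 0 < ε ∧ J = span {(cutDown b ε : A)}}
  have hdir : DirectedOn (· ≤ ·) D := by
    rintro _ ⟨s, hs, rfl⟩ _ ⟨t, ht, rfl⟩
    exact ⟨_, ⟨min s t, lt_min hs ht, rfl⟩, hanti (lt_min hs ht) (min_le_left s t),
      hanti (lt_min hs ht) (min_le_right s t)⟩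
  have hsup : I ≤ sSup D := by
    rw [← hb, span_singleton_le]
    refine mem_of_forall_cutDown_mem _ fun ε hε => ?_
    have hD : span {(cutDown b ε : A)} ∈ D := ⟨ε, hε, rfl⟩
    exact le_sSup hD (mem_span_singleton_self _)
  obtain ⟨_, ⟨ε, hε, rfl⟩, hle⟩ := hI D ⟨_, 1, one_pos, rfl⟩ hdir hsup
  refine ⟨ε, hε, le_antisymm (span_singleton_le.mpr ?_) hle⟩
  exact cutDown_mem I (hb ▸ mem_span_singleton_self _) ε

theorem ClosedIdeal.span_star_mul_self (a : A) : span {star a * a} = span {a} := by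
  refine le_antisymm (span_singleton_le.mpr ?_) (span_singleton_le.mpr ?_)
  · exact mul_mem_left _ _ (mem_span_singleton_self a)
  · rw [← star_mul_self_mem_iff]
    exact mem_span_singleton_self _

open Trace in
-- Replace the generator `a` by `a⋆a`, then cut it down slightly: it still generates `I` by
-- compactness and now lies in the Pedersen ideal.
theorem ClosedIdeal.exists_isFull_of_isCompactElement {I : ClosedIdeal A}
    (h1 : I.IsSinglyGenerated) (h2 : IsCompactElement I) :
    ∃ e : I, e ∈ pedersenIdeal I ∧ IsFull e := by
  obtain ⟨a, ha⟩ := h1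
  have hb : span {star a * a} = I := by rw [span_star_mul_self, ha]
  obtain ⟨ε, hε, hs⟩ := exists_span_cutDown_eq h2 (b := ⟨star a * a, star_mul_self_nonneg a⟩) hb
  exact ⟨_, cutDown_mem_pedersenIdeal I (hb ▸ mem_span_singleton_self _) hε, isFull_iff.mpr hs⟩

theorem ClosedIdeal.tfae_compact (I : ClosedIdeal A) :
    List.TFAE [I.IsSinglyGenerated ∧ IsCompactElement I, ∃ e : I, e ∈ pedersenIdeal I ∧ IsFull e,
      CompactSpace (Prim I)] := by
  tfae_have 1 → 2 := fun h => exists_isFull_of_isCompactElement h.1 h.2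
  tfae_have 2 → 3 := fun ⟨_, he, hf⟩ =>
    compactSpace_prim_of_isCompactElement_top (isCompactElement_top_of_isFull he hf)
  tfae_have 3 → 2 := fun _ => by
    obtain ⟨c, h1, h2⟩ := exists_isFull_of_compactSpace_prim (A := I)
    exact ⟨_, h1, h2⟩
  tfae_have 2 → 1 := fun ⟨e, he, hf⟩ =>
    ⟨⟨e, (isFull_iff.mp hf).symm⟩, isCompactElement_of_isFull he hf⟩
  tfae_finish

end Order

end Compactness


/-! ### Hereditary tracial predicates and their ideals -/

section IdealPredicates

variable {A : Type u} [NonUnitalCStarAlgebra A] [PartialOrder A] [StarOrderedRing A]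

namespace Trace

/-- The positive element `x⋆x`. -/
def starMul (x : A) : Pos A := ⟨star x * x, star_mul_self_nonneg x⟩

/-- A nonnegative real multiple of a positive element. -/
noncomputable def scale (r : ℝ≥0) (a : Pos A) : Pos A := ⟨(r : ℝ) • a.1, smul_nonneg r.2 a.2⟩

theorem coe_starMul (x : A) : (starMul x : A) = star x * x := rfl

theorem coe_scale (r : ℝ≥0) (a : Pos A) : (scale r a : A) = (r : ℝ) • (a : A) := rfl

theorem exists_eq_starMul (a : Pos A) : ∃ x, a = starMul x := by
  obtain ⟨x, hx⟩ := CStarAlgebra.nonneg_iff_eq_star_mul_self.mp a.2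
  exact ⟨x, Subtype.ext hx⟩

theorem starMul_star (x : A) : starMul (star x) = ⟨x * star x, mul_star_self_nonneg x⟩ :=
  Subtype.ext (by rw [coe_starMul, star_star])

theorem starMul_mul_le (b x : A) :
    (starMul (b * x) : A) ≤ scale ‖star b * b‖₊ (starMul x) := by
  rw [coe_starMul, coe_scale, coe_starMul, star_mul, mul_assoc, ← mul_assoc (star b),
    ← mul_assoc (star x)]
  exact CStarAlgebra.star_left_conjugate_le_norm_smul

theorem starMul_add_le (x y : A) :
    (starMul (x + y) : A) ≤ (starMul x + starMul y) + (starMul x + starMul y) := by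
  have : (star x * x + star y * y) + (star x * x + star y * y) - star (x + y) * (x + y) =
      star (x - y) * (x - y) := by
    rw [star_add, star_sub]; noncomm_ring
  exact sub_nonneg.mp (this ▸ star_mul_self_nonneg (x - y))

theorem starMul_smul (c : ℂ) (x : A) : starMul (c • x) = scale (‖c‖₊ ^ 2) (starMul x) := by
  refine Subtype.ext ?_
  rw [coe_starMul, coe_scale, coe_starMul, star_smul, smul_mul_assoc, mul_smul_comm, smul_smul,
    Complex.star_def, Complex.conj_mul', ← Complex.coe_smul]
  push_cast
  rfl

/-- The square root of `cutDown a ε`. -/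
noncomputable def sqrtCut (a : Pos A) (ε : ℝ) : A := cfcₙ (fun t : ℝ => √(max 0 (t - ε))) (a : A)

theorem star_sqrtCut (a : Pos A) (ε : ℝ) : star (sqrtCut a ε) = sqrtCut a ε :=
  (cfcₙ_predicate _ (a : A) : IsSelfAdjoint (sqrtCut a ε)).star_eq

theorem sqrtCut_mul_self (a : Pos A) {ε : ℝ} (hε : 0 ≤ ε) :
    sqrtCut a ε * sqrtCut a ε = cutDown a ε := by
  rw [sqrtCut, ← cfcₙ_mul (fun t : ℝ => √(max 0 (t - ε))) (fun t : ℝ => √(max 0 (t - ε))) (a : A)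
    (by fun_prop) (by simp [hε]) (by fun_prop) (by simp [hε]), coe_cutDown]
  congr 1
  funext t
  exact Real.mul_self_sqrt (le_max_left _ _)

theorem starMul_sqrtCut (a : Pos A) {ε : ℝ} (hε : 0 ≤ ε) : starMul (sqrtCut a ε) = cutDown a ε :=
  Subtype.ext (by rw [coe_starMul, star_sqrtCut, sqrtCut_mul_self a hε])

theorem plateau_mul_sqrtCut (a : Pos A) {ε : ℝ} (hε : 0 < ε) :
    plateau (a : A) ε * sqrtCut a ε = sqrtCut a ε :=
  plateau_mul_cfcₙ a.2 hε (by fun_prop) fun t ht => by simp [ht]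

/-- A predicate on positive elements whose set of solutions is a hereditary cone that is invariant
under exchanging `x⋆x` and `xx⋆`. -/
structure IsIdealPredicate (p : Pos A → Prop) : Prop where
  zero : p 0
  add : ∀ {a b}, p a → p b → p (a + b)
  smul : ∀ (r : ℝ≥0) {a}, p a → p (scale r a)
  mono : ∀ {a b : Pos A}, (a : A) ≤ b → p b → p a
  trace : ∀ {x}, p (starMul x) → p (starMul (star x))

namespace IsIdealPredicate

variable {p : Pos A → Prop}

/-- The two-sided ideal of all `x` such that `x⋆x` satisfies the predicate. -/
def sqIdeal (hp : IsIdealPredicate p) : Submodule ℂ A where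
  carrier := {x | p (starMul x)}
  add_mem' {x y} hx hy := hp.mono (starMul_add_le x y) (hp.add (hp.add hx hy) (hp.add hx hy))
  zero_mem' := hp.mono (b := 0) (by rw [coe_starMul, mul_zero]; exact le_rfl) hp.zero
  smul_mem' c x hx := by
    change p (starMul (c • x))
    rw [starMul_smul]
    exact hp.smul _ hx

theorem mem_sqIdeal (hp : IsIdealPredicate p) {x : A} : x ∈ hp.sqIdeal ↔ p (starMul x) := Iff.rfl

theorem star_mem_sqIdeal (hp : IsIdealPredicate p) {x : A} (hx : x ∈ hp.sqIdeal) : star x ∈ hp.sqIdeal := hp.trace hx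

theorem isTwoSidedIdeal_sqIdeal (hp : IsIdealPredicate p) : IsTwoSidedIdeal hp.sqIdeal := by
  have hl : ∀ b x, x ∈ hp.sqIdeal → b * x ∈ hp.sqIdeal := fun b x hx =>
    hp.mono (starMul_mul_le b x) (hp.smul _ hx)
  refine fun b x hx => ⟨hl b x hx, ?_⟩
  have := hp.star_mem_sqIdeal (hl (star b) _ (hp.star_mem_sqIdeal hx))
  rwa [star_mul, star_star, star_star] at this

/-- The plateau of `a` lies in the closure of `sqIdeal` and is a local unit for the square root of
`(a - ε)₊`; that square root therefore lies in `sqIdeal` itself. -/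
theorem cutDown_of_le_closure (hp : IsIdealPredicate p) {I : ClosedIdeal A} (hI : I ≤ hp.isTwoSidedIdeal_sqIdeal.closure)
    {a : Pos A} (ha : (a : A) ∈ I) {ε : ℝ} (hε : 0 < ε) : p (cutDown a ε) := by
  have := hp.isTwoSidedIdeal_sqIdeal.mem_of_mul_eq_self (hI (plateau_mem I a.2 ha ε))
    (plateau_mul_sqrtCut a hε)
  rwa [mem_sqIdeal, starMul_sqrtCut a hε.le] at this

/-- Expanding `0 ≤ (x - c y)⋆(x - c y)` bounds twice the real part of `c x⋆y` by `x⋆x + |c|² y⋆y`.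
The bound is stated for all scalars `c` at once so that it passes through scalar multiples in the
span induction. -/
theorem exists_bound_of_mem_span (hp : IsIdealPredicate p) {z : A}
    (hz : z ∈ Submodule.span ℂ {z | ∃ x ∈ hp.sqIdeal, ∃ y ∈ hp.sqIdeal, z = star x * y}) :
    ∃ w : Pos A, p w ∧ ∀ c : ℂ, c • z + star (c • z) ≤ ((1 + ‖c‖ ^ 2 : ℝ)) • (w : A) := by
  induction hz using Submodule.span_induction with
  | mem z h =>
    obtain ⟨x, hx, y, hy, rfl⟩ := h
    refine ⟨starMul x + starMul y, hp.add hx hy, fun c => ?_⟩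
    have h1 : 0 ≤ star (x - c • y) * (x - c • y) := star_mul_self_nonneg _
    have h2 : star (x - c • y) * (x - c • y) = star x * x + star (c • y) * (c • y) -
        (c • (star x * y) + star (c • (star x * y))) := by
      simp only [star_sub, star_smul, star_mul, star_star, sub_mul, mul_sub, smul_mul_assoc,
        mul_smul_comm]
      module
    rw [h2, ← coe_starMul (c • y), starMul_smul, coe_scale] at h1
    refine (sub_nonneg.mp h1).trans ?_
    change _ ≤ _ • (star x * x + star y * y)
    have h3 : (1 + ‖c‖ ^ 2 : ℝ) • (star x * x + star y * y) -
        (star x * x + ((‖c‖₊ ^ 2 : ℝ≥0) : ℝ) • (star y * y)) =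
        (‖c‖ ^ 2 : ℝ) • (star x * x) + star y * y := by
      push_cast
      module
    rw [← sub_nonneg, coe_starMul, h3]
    exact add_nonneg (smul_nonneg (sq_nonneg _) (star_mul_self_nonneg x)) (star_mul_self_nonneg y)
  | zero =>
    refine ⟨0, hp.zero, fun c => ?_⟩
    rw [smul_zero, star_zero, add_zero]
    exact (smul_zero _).ge
  | add y z _ _ hy hz =>
    obtain ⟨v, hv, hvy⟩ := hy
    obtain ⟨w, hw, hwz⟩ := hz
    refine ⟨v + w, hp.add hv hw, fun c => ?_⟩
    change _ ≤ _ • ((v : A) + w)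
    rw [smul_add, smul_add, star_add]
    calc _ = (c • y + star (c • y)) + (c • z + star (c • z)) := by abel
      _ ≤ _ := add_le_add (hvy c) (hwz c)
  | smul r z _ hz =>
    obtain ⟨w, hw, hwz⟩ := hz
    refine ⟨scale (1 + ‖r‖₊ ^ 2) w, hp.smul _ hw, fun c => ?_⟩
    rw [smul_smul]
    refine (hwz (c * r)).trans ?_
    rw [coe_scale, smul_smul]
    have : 1 + ‖c * r‖ ^ 2 ≤ (1 + ‖c‖ ^ 2) * ((1 + ‖r‖₊ ^ 2 : ℝ≥0) : ℝ) := by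
      push_cast
      rw [norm_mul]
      nlinarith [sq_nonneg ‖c‖, sq_nonneg ‖r‖]
    exact smul_le_smul_of_nonneg_right this w.2

/-- A predicate that holds for all cut-downs of positive elements of `I` holds for all positive
elements of the Pedersen ideal of `I`. -/
theorem of_mem_pedersenIdeal (hp : IsIdealPredicate p) {I : ClosedIdeal A}
    (hI : ∀ a : Pos A, (a : A) ∈ I → ∀ ε, 0 < ε → p (cutDown a ε)) {e : I} (he : 0 ≤ (e : A))
    (heP : e ∈ pedersenIdeal I) : p ⟨e, he⟩ := by
  -- The span of products of two elements of `sqIdeal` is a two-sided ideal containing every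
  -- cut-down of an element of `I₊`, being the square of its square root. It meets `I` in a dense
  -- ideal, which contains `e`.
  set M := Submodule.span ℂ {z | ∃ x ∈ hp.sqIdeal, ∃ y ∈ hp.sqIdeal, z = star x * y} with hM
  have hMid : IsTwoSidedIdeal M := by
    intro b z hz
    induction hz using Submodule.span_induction with
    | mem z h =>
      obtain ⟨x, hx, y, hy, rfl⟩ := h
      refine ⟨Submodule.subset_span ⟨x * star b, (hp.isTwoSidedIdeal_sqIdeal _ x hx).2, y, hy, ?_⟩,
        Submodule.subset_span ⟨x, hx, y * b, (hp.isTwoSidedIdeal_sqIdeal _ y hy).2, ?_⟩⟩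
      · rw [star_mul, star_star, mul_assoc]
      · rw [mul_assoc]
    | zero => rw [mul_zero, zero_mul]; exact ⟨M.zero_mem, M.zero_mem⟩
    | add y z _ _ hy hz =>
      rw [mul_add, add_mul]
      exact ⟨M.add_mem hy.1 hz.1, M.add_mem hy.2 hz.2⟩
    | smul r z _ hz =>
      rw [mul_smul_comm, smul_mul_assoc]
      exact ⟨M.smul_mem r hz.1, M.smul_mem r hz.2⟩
  have hle : I ≤ hMid.closure := by
    intro x hx
    rw [← ClosedIdeal.star_mul_self_mem_iff]
    refine mem_of_forall_cutDown_mem _ (a := starMul x) fun ε hε => hMid.subset_closure ?_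
    have hN : sqrtCut (starMul x) ε ∈ hp.sqIdeal := by
      rw [mem_sqIdeal, starMul_sqrtCut _ hε.le]
      exact hI _ (I.mul_mem_left _ hx) ε hε
    rw [← starMul_sqrtCut _ hε.le]
    exact Submodule.subset_span ⟨_, hN, _, hN, rfl⟩
  obtain ⟨V, hV, hd, hmem⟩ := hMid.dense_comap hle
  obtain ⟨w, hw, hwe⟩ := hp.exists_bound_of_mem_span ((hmem e).mp (hV.pedersenIdeal_le hd heP))
  -- With `c = 1` the bound reads `e + e⋆ ≤ (1 + 1) w`, and `e ≤ e + e⋆` because `e` is positive.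
  refine hp.mono (b := scale 2 w) ?_ (hp.smul 2 hw)
  have h1 := hwe 1
  rw [one_smul, (IsSelfAdjoint.of_nonneg he).star_eq, norm_one] at h1
  rw [coe_scale]
  refine (le_add_of_nonneg_left he).trans (h1.trans_eq ?_)
  norm_num

end IsIdealPredicate

/-! ### Tracial weights -/

/-- An additive, positively homogeneous and tracial map `A₊ → [0, ∞]`. -/
structure IsTracial (f : Pos A → ℝ≥0∞) : Prop where
  map_zero : f 0 = 0
  map_add : ∀ a b, f (a + b) = f a + f b
  map_smul : ∀ (r : ℝ≥0) (a : Pos A), 0 < r → f (scale r a) = r * f a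
  map_star : ∀ x, f (starMul (star x)) = f (starMul x)

theorem isTracial (τ : Trace A) : IsTracial τ where
  map_zero := τ.map_zero'
  map_add := τ.map_add'
  map_smul := τ.map_smul'
  map_star x := by rw [starMul_star]; exact τ.map_mul_star' x

theorem IsTracial.map_sub {f : Pos A → ℝ≥0∞} (hf : IsTracial f) {a b : Pos A}
    (h : (a : A) ≤ b) : f b = f a + f ⟨(b : A) - a, sub_nonneg.mpr h⟩ := by
  rw [← hf.map_add]
  congr 1
  exact Subtype.ext (add_sub_cancel (a : A) (b : A)).symm

theorem IsTracial.mono {f : Pos A → ℝ≥0∞} (hf : IsTracial f) {a b : Pos A}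
    (h : (a : A) ≤ b) : f a ≤ f b := by
  rw [hf.map_sub h]
  exact le_self_add

theorem IsTracial.map_scale_le {f : Pos A → ℝ≥0∞} (hf : IsTracial f) (r : ℝ≥0) (a : Pos A) :
    f (scale r a) = r * f a := by
  rcases eq_or_ne r 0 with rfl | hr
  · have : scale 0 a = 0 := Subtype.ext (zero_smul ℝ (a : A))
    rw [this, hf.map_zero, ENNReal.coe_zero, zero_mul]
  · exact hf.map_smul r a (pos_iff_ne_zero.mpr hr)

theorem IsTracial.isIdealPredicate_lt_top {f : Pos A → ℝ≥0∞} (hf : IsTracial f) :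
    IsIdealPredicate fun a => f a < ∞ where
  zero := by rw [hf.map_zero]; exact ENNReal.zero_lt_top
  add ha hb := by rw [hf.map_add]; exact ENNReal.add_lt_top.mpr ⟨ha, hb⟩
  smul r a ha := by rw [hf.map_scale_le]; exact ENNReal.mul_lt_top ENNReal.coe_lt_top ha
  mono h hb := (hf.mono h).trans_lt hb
  trace hx := by rwa [hf.map_star]

theorem IsTracial.isIdealPredicate_eq_zero {f : Pos A → ℝ≥0∞} (hf : IsTracial f) :
    IsIdealPredicate fun a => f a = 0 where
  zero := hf.map_zero
  add ha hb := by rw [hf.map_add, ha, hb, add_zero]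
  smul r a ha := by rw [hf.map_scale_le, ha, mul_zero]
  mono h hb := le_antisymm ((hf.mono h).trans_eq hb) (zero_le)
  trace hx := by rwa [hf.map_star]

/-- The set where two comparable tracial weights agree and are finite is hereditary. -/
theorem IsTracial.isIdealPredicate_eq {f g : Pos A → ℝ≥0∞} (hf : IsTracial f) (hg : IsTracial g)
    (hle : ∀ a, f a ≤ g a) : IsIdealPredicate fun a => f a = g a ∧ g a < ∞ where
  zero := by rw [hf.map_zero, hg.map_zero]; exact ⟨rfl, ENNReal.zero_lt_top⟩
  add ha hb := by
    rw [hf.map_add, hg.map_add, ha.1, hb.1]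
    exact ⟨rfl, ENNReal.add_lt_top.mpr ⟨ha.2, hb.2⟩⟩
  smul r a ha := by
    rw [hf.map_scale_le, hg.map_scale_le, ha.1]
    exact ⟨rfl, ENNReal.mul_lt_top ENNReal.coe_lt_top ha.2⟩
  mono {a b} h hb := by
    have hga : g a < ∞ := (hg.mono h).trans_lt hb.2
    refine ⟨le_antisymm (hle a) ?_, hga⟩
    have h1 := hb.1
    rw [hf.map_sub h, hg.map_sub h] at h1
    have h2 : g a + g ⟨(b : A) - a, sub_nonneg.mpr h⟩ ≤
        f a + g ⟨(b : A) - a, sub_nonneg.mpr h⟩ := h1 ▸ add_le_add_right (hle _) (f a)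
    have h3 : g ⟨(b : A) - a, sub_nonneg.mpr h⟩ ≠ ∞ := by
      have := hb.2
      rw [hg.map_sub h] at this
      exact (ENNReal.add_lt_top.mp this).2.ne
    exact (ENNReal.add_le_add_iff_right h3).mp h2
  trace hx := by rwa [hf.map_star, hg.map_star]

end Trace

end IdealPredicates


/-! ### Traces with a prescribed support idempotent -/

section Supports

variable {A : Type u} [NonUnitalCStarAlgebra A] [PartialOrder A] [StarOrderedRing A]

namespace Trace

theorem le_of_forall_cutDown_le (τ : Trace A) {a : Pos A} {c : ℝ≥0∞}
    (h : ∀ ε, 0 < ε → τ (cutDown a ε) ≤ c) : τ a ≤ c := by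
  have hcl : IsClosed {b : Pos A | τ b ≤ c} := τ.lsc'.isClosed_preimage c
  refine hcl.closure_subset (Metric.mem_closure_iff.mpr fun ε hε => ⟨cutDown a (ε / 2),
    h _ (by linarith), ?_⟩)
  rw [Subtype.dist_eq, dist_eq_norm]
  exact (norm_sub_cutDown_le a (by linarith)).trans_lt (by linarith)

theorem ofIdeal_of_mem {I : ClosedIdeal A} {a : Pos A} (ha : (a : A) ∈ I) : ofIdeal I a = 0 :=
  if_pos ha

theorem ofIdeal_of_notMem {I : ClosedIdeal A} {a : Pos A} (ha : (a : A) ∉ I) : ofIdeal I a = ∞ :=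
  if_neg ha

theorem starMul_mem_iff (I : ClosedIdeal A) {x : A} : (starMul x : A) ∈ I ↔ x ∈ I :=
  I.star_mul_self_mem_iff

theorem ofIdeal_le_iff {I J : ClosedIdeal A} : ofIdeal I ≤ ofIdeal J ↔ J ≤ I := by
  constructor
  · intro h x hx
    by_contra hI
    have h1 : ofIdeal I (starMul x) ≤ ofIdeal J (starMul x) := h _
    rw [ofIdeal_of_mem ((starMul_mem_iff J).mpr hx),
      ofIdeal_of_notMem (mt (starMul_mem_iff I).mp hI)] at h1
    exact ENNReal.top_ne_zero (le_zero_iff.mp h1)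
  · intro h a
    change ofIdeal I a ≤ ofIdeal J a
    by_cases ha : (a : A) ∈ J
    · rw [ofIdeal_of_mem (h ha)]; exact zero_le
    · rw [ofIdeal_of_notMem ha]; exact le_top

theorem ofIdeal_injective {I J : ClosedIdeal A} (h : ofIdeal I = ofIdeal J) : I = J :=
  le_antisymm (ofIdeal_le_iff.mp h.ge) (ofIdeal_le_iff.mp h.le)

/-- The closed ideal generated by the positive elements on which a trace is finite. -/
def finiteIdeal (τ : Trace A) : ClosedIdeal A :=
  τ.isTracial.isIdealPredicate_lt_top.isTwoSidedIdeal_sqIdeal.closure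

theorem mem_finiteIdeal_of_lt_top (τ : Trace A) {a : Pos A} (h : τ a < ∞) :
    (a : A) ∈ τ.finiteIdeal := by
  obtain ⟨x, rfl⟩ := exists_eq_starMul a
  exact (starMul_mem_iff _).mpr (IsTwoSidedIdeal.subset_closure _ h)

/-- The kernel of a trace contains the closure of each set of elements it annihilates. -/
theorem eq_zero_of_mem_closure (τ : Trace A) {J : Submodule ℂ A} (hJ : IsTwoSidedIdeal J)
    (h : ∀ x ∈ J, τ (starMul x) = 0) {a : Pos A} (ha : (a : A) ∈ hJ.closure) : τ a = 0 := by
  obtain ⟨x, rfl⟩ := exists_eq_starMul a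
  have hcont : Continuous (starMul : A → Pos A) :=
    Continuous.subtype_mk (by fun_prop) _
  have hcl : IsClosed {x : A | τ (starMul x) ≤ 0} :=
    (τ.lsc'.isClosed_preimage 0).preimage hcont
  have hx : x ∈ hJ.closure := (starMul_mem_iff _).mp ha
  exact le_zero_iff.mp (closure_minimal (fun y hy => (h y hy).le) hcl hx)

/-- An idempotent trace takes only the values 0 and ∞. If it lies below `τ`, it vanishes wherever
`τ` is finite, hence on the closed ideal so generated by lower semicontinuity; off that ideal `τ` is
infinite. So the supremum is attained. -/
theorem isLUB_ofIdeal_finiteIdeal (τ : Trace A) :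
    IsLUB {e : Trace A | e + e = e ∧ e ≤ τ} (ofIdeal τ.finiteIdeal) := by
  refine IsGreatest.isLUB ⟨⟨ext fun a => ?_, fun a => ?_⟩, ?_⟩
  · rw [add_apply]
    by_cases ha : (a : A) ∈ τ.finiteIdeal
    · rw [ofIdeal_of_mem ha, add_zero]
    · rw [ofIdeal_of_notMem ha, add_top]
  · change ofIdeal _ a ≤ τ a
    by_cases ha : (a : A) ∈ τ.finiteIdeal
    · rw [ofIdeal_of_mem ha]; exact zero_le
    · have : τ a = ∞ := by
        by_contra h
        exact ha (τ.mem_finiteIdeal_of_lt_top (lt_top_iff_ne_top.mpr h))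
      rw [this]; exact le_top
  · rintro e ⟨hee, heτ⟩ a
    change e a ≤ ofIdeal _ a
    by_cases ha : (a : A) ∈ τ.finiteIdeal
    · refine (e.eq_zero_of_mem_closure _ (fun x hx => ?_) ha).le.trans zero_le
      have h1 : e (starMul x) < ∞ := (heτ (starMul x)).trans_lt hx
      have h2 : e (starMul x) + e (starMul x) = e (starMul x) + 0 := by
        rw [← add_apply, hee, add_zero]
      exact (ENNReal.add_right_inj h1.ne).mp h2
    · rw [ofIdeal_of_notMem ha]; exact le_top

theorem mem_supportedOn_iff_finiteIdeal {I : ClosedIdeal A} {τ : Trace A} :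
    τ ∈ supportedOn I ↔ τ.finiteIdeal = I :=
  ⟨fun h => ofIdeal_injective (τ.isLUB_ofIdeal_finiteIdeal.unique h),
    fun h => h ▸ τ.isLUB_ofIdeal_finiteIdeal⟩

/-- `T_I(A)` consists of the traces that are densely finite on `I` and infinite outside `I`. -/
theorem mem_supportedOn_iff {I : ClosedIdeal A} {τ : Trace A} :
    τ ∈ supportedOn I ↔ (∀ a : Pos A, (a : A) ∈ I → ∀ ε, 0 < ε → τ (cutDown a ε) < ∞) ∧
      ∀ a : Pos A, (a : A) ∉ I → τ a = ∞ := by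
  rw [mem_supportedOn_iff_finiteIdeal]
  constructor
  · intro h
    refine ⟨fun a ha ε hε => ?_, fun a ha => ?_⟩
    · exact τ.isTracial.isIdealPredicate_lt_top.cutDown_of_le_closure h.ge ha hε
    · by_contra hn
      exact ha (h ▸ τ.mem_finiteIdeal_of_lt_top (lt_top_iff_ne_top.mpr hn))
  · rintro ⟨h1, h2⟩
    refine le_antisymm ?_ fun x hx => ?_
    · refine fun x hx => closure_minimal (fun y hy => ?_) I.isClosed hx
      by_contra hyI
      exact (show τ (starMul y) < ∞ from hy).ne (h2 _ (mt (starMul_mem_iff I).mp hyI))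
    · rw [← starMul_mem_iff]
      exact mem_of_forall_cutDown_mem _ fun ε hε => τ.mem_finiteIdeal_of_lt_top
        (h1 _ ((starMul_mem_iff I).mpr hx) ε hε)

theorem isSubcone_supportedOn (I : ClosedIdeal A) : IsSubcone (supportedOn I) (ofIdeal I) where
  add_mem σ hσ τ hτ := by
    rw [mem_supportedOn_iff] at *
    refine ⟨fun a ha ε hε => ?_, fun a ha => ?_⟩ <;> rw [add_apply]
    · exact ENNReal.add_lt_top.mpr ⟨hσ.1 a ha ε hε, hτ.1 a ha ε hε⟩
    · rw [hσ.2 a ha, top_add]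
  smul_mem r hr τ hτ := by
    rw [mem_supportedOn_iff] at *
    refine ⟨fun a ha ε hε => ?_, fun a ha => ?_⟩ <;> rw [smul_apply]
    · exact ENNReal.mul_lt_top ENNReal.coe_lt_top (hτ.1 a ha ε hε)
    · rw [hτ.2 a ha, ENNReal.mul_top (by exact_mod_cast hr.ne')]
  neutral_mem := by
    rw [mem_supportedOn_iff]
    refine ⟨fun a ha ε hε => ?_, fun a ha => ofIdeal_of_notMem ha⟩
    rw [ofIdeal_of_mem (cutDown_mem I ha ε)]
    exact ENNReal.zero_lt_top
  add_neutral τ hτ := by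
    rw [mem_supportedOn_iff] at hτ
    refine ext fun a => ?_
    rw [add_apply]
    by_cases ha : (a : A) ∈ I
    · rw [ofIdeal_of_mem ha, add_zero]
    · rw [hτ.2 a ha, top_add]

/-- On cut-downs of elements of `I₊` the summand `ρ` is finite and cancels; lower semicontinuity
recovers the remaining values on `I₊`. -/
theorem isCancellative_supportedOn (I : ClosedIdeal A) : IsCancellative (supportedOn I) := by
  have key : ∀ ρ ∈ supportedOn I, ∀ σ ∈ supportedOn I, ∀ τ ∈ supportedOn I,
      σ + ρ = τ + ρ → ∀ a, σ a ≤ τ a := by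
    intro ρ hρ σ hσ τ hτ h a
    rw [mem_supportedOn_iff] at *
    by_cases ha : (a : A) ∈ I
    · refine σ.le_of_forall_cutDown_le fun ε hε => ?_
      have h1 : σ (cutDown a ε) + ρ (cutDown a ε) = τ (cutDown a ε) + ρ (cutDown a ε) := by
        rw [← add_apply, h, add_apply]
      rw [(ENNReal.add_left_inj (hρ.1 a ha ε hε).ne).mp h1]
      exact τ.mono (cutDown_le_self a hε.le)
    · rw [hτ.2 a ha]; exact le_top
  intro ρ hρ σ hσ τ hτ h
  exact ext fun a => le_antisymm (key ρ hρ σ hσ τ hτ h a) (key ρ hρ τ hτ σ hσ h.symm a)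

/-- Cut-downs of elements of the closed ideal generated by `e` are bounded by multiples of `e`,
uniformly over all traces. -/
theorem exists_forall_cutDown_le_mul {e : Pos A} {a : Pos A}
    (ha : (a : A) ∈ ClosedIdeal.span {(e : A)}) {ε : ℝ} (hε : 0 < ε) :
    ∃ C : ℝ≥0, ∀ σ : Trace A, σ (cutDown a ε) ≤ C * σ e := by
  -- Being dominated by a multiple of `e`, uniformly over all traces, is an ideal predicate. It
  -- holds at `e` with constant 1, so its ideal is dense in the one generated by `e`.
  have hp : IsIdealPredicate fun b : Pos A => ∃ C : ℝ≥0, ∀ σ : Trace A, σ b ≤ C * σ e :=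
    { zero := ⟨0, fun σ => by rw [σ.isTracial.map_zero]; exact zero_le⟩
      add := by
        rintro a b ⟨C, hC⟩ ⟨D, hD⟩
        refine ⟨C + D, fun σ => ?_⟩
        rw [σ.isTracial.map_add, ENNReal.coe_add, add_mul]
        exact add_le_add (hC σ) (hD σ)
      smul := by
        rintro r a ⟨C, hC⟩
        refine ⟨r * C, fun σ => ?_⟩
        rw [σ.isTracial.map_scale_le, ENNReal.coe_mul, mul_assoc]
        gcongr
        exact hC σ
      mono := by
        rintro a b h ⟨C, hC⟩
        exact ⟨C, fun σ => (σ.mono h).trans (hC σ)⟩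
      trace := by
        rintro x ⟨C, hC⟩
        exact ⟨C, fun σ => by rw [σ.isTracial.map_star]; exact hC σ⟩ }
  refine hp.cutDown_of_le_closure (ClosedIdeal.span_singleton_le.mpr ?_) ha hε
  refine IsTwoSidedIdeal.subset_closure _ ?_
  obtain ⟨c, rfl⟩ := exists_eq_starMul e
  have hc : c ∈ hp.sqIdeal := ⟨1, fun σ => by rw [ENNReal.coe_one, one_mul]⟩
  exact (hp.isTwoSidedIdeal_sqIdeal _ c hc).1

end Trace

end Supports


/-! ### Lower-semicontinuous regularization -/

section Regularization

variable {A : Type u} [NonUnitalCStarAlgebra A] [PartialOrder A] [StarOrderedRing A]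

namespace Trace

/-- The trace property turns `g⋆c⋆c g` into `c g g⋆c⋆`, which is at most `c c⋆`. -/
theorem IsTracial.starMul_mul_right_le {f : Pos A → ℝ≥0∞} (hf : IsTracial f) (c : A) {g : A}
    (hg : ‖g‖ ≤ 1) : f (starMul (c * g)) ≤ f (starMul c) := by
  have h1 : ‖star (star g) * star g‖₊ ≤ 1 := by
    have : ‖star (star g) * star g‖ ≤ 1 := by
      rw [CStarRing.norm_star_mul_self, norm_star]
      nlinarith [norm_nonneg g]
    exact_mod_cast this
  calc f (starMul (c * g)) = f (starMul (star g * star c)) := by rw [← star_mul, hf.map_star]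
    _ ≤ f (scale _ (starMul (star c))) := hf.mono (starMul_mul_le (star g) (star c))
    _ = ‖star (star g) * star g‖₊ * f (starMul c) := by rw [hf.map_scale_le, hf.map_star]
    _ ≤ 1 * f (starMul c) := by gcongr; exact_mod_cast h1
    _ = f (starMul c) := one_mul _

/-- A tracial weight of a cut-down of `x` is bounded by the weight of every nearby element. -/
theorem IsTracial.cutDown_le_of_norm_sub_le {f : Pos A → ℝ≥0∞} (hf : IsTracial f) {x y : Pos A}
    {η δ : ℝ} (hη : 0 ≤ η) (hηδ : η < δ) (hxy : ‖(x : A) - y‖ ≤ η) : f (cutDown x δ) ≤ f y := by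
  obtain ⟨c, rfl⟩ := exists_eq_starMul y
  have hd : 0 < δ - η := by linarith
  -- A ramp from 0 at `η` to 1 at `δ`. With `w = g(x)` one gets `(x - δ)₊ ≤ w x w - η w² ≤ w y w`,
  -- and `f (w y w) ≤ f y` since `w` is a contraction.
  set g : ℝ → ℝ := fun t => max 0 (min 1 ((t - η) / (δ - η))) with hgdef
  have hgc : Continuous g := by fun_prop
  have hgz : ∀ t, t ≤ η → g t = 0 := fun t ht =>
    max_eq_left ((min_le_right _ _).trans (div_nonpos_of_nonpos_of_nonneg (by linarith) hd.le))
  have hg0 : g 0 = 0 := hgz 0 hη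
  have hg1 : ∀ t, δ ≤ t → g t = 1 := fun t ht => by
    have : (1 : ℝ) ≤ (t - η) / (δ - η) := (one_le_div hd).mpr (by linarith)
    simp only [hgdef]
    rw [min_eq_left this, max_eq_right zero_le_one]
  set w : A := cfcₙ g (x : A) with hw
  have hsa : IsSelfAdjoint (x : A) := .of_nonneg x.2
  have hwsa : star w = w := (cfcₙ_predicate g (x : A) : IsSelfAdjoint w).star_eq
  have hwn : ‖w‖ ≤ 1 := norm_cfcₙ_le fun t _ => by
    rw [Real.norm_eq_abs, abs_of_nonneg (le_max_left _ _)]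
    exact max_le zero_le_one (min_le_left _ _)
  have hid : cfcₙ (fun t : ℝ => t) (x : A) = x := cfcₙ_id' ℝ (x : A)
  have e1 : cfcₙ (fun t => g t * t * g t) (x : A) = w * x * w := by
    rw [cfcₙ_mul (fun t => g t * t) g (x : A) (by fun_prop) (by simp) (by fun_prop) hg0,
      cfcₙ_mul g (fun t => t) (x : A) (by fun_prop) hg0 (by fun_prop) rfl, hid]
  have e2 : cfcₙ (fun t => η * (g t * g t)) (x : A) = η • (w * w) := by
    rw [cfcₙ_const_mul η (fun t => g t * g t) (x : A) (by fun_prop) (by simp [hg0]),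
      cfcₙ_mul g g (x : A) (by fun_prop) hg0 (by fun_prop) hg0]
  have h1 : (cutDown x δ : A) ≤ w * x * w - η • (w * w) := by
    rw [← e1, ← e2, ← cfcₙ_sub (fun t => g t * t * g t) (fun t => η * (g t * g t)) (x : A)
      (by fun_prop) (by simp) (by fun_prop) (by simp [hg0]), coe_cutDown]
    refine cfcₙ_mono_of_nonneg x.2 (by fun_prop) (by fun_prop) (by simp; linarith) (by simp [hg0])
      fun t ht => ?_
    have : g t * t * g t - η * (g t * g t) = g t * g t * (t - η) := by ring
    rw [this]
    rcases le_total t δ with h | h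
    · rw [max_eq_left (by linarith)]
      rcases le_total t η with h' | h'
      · rw [hgz t h']; simp
      · exact mul_nonneg (mul_self_nonneg _) (by linarith)
    · rw [hg1 t h, max_eq_right (by linarith)]; linarith
  have h2 : w * ((x : A) - starMul c) * w ≤ η • (w * w) := by
    have hsa' : IsSelfAdjoint ((x : A) - starMul c) := hsa.sub (.of_nonneg (starMul c).2)
    have := CStarAlgebra.star_left_conjugate_le_norm_smul (a := w) hsa'
    rw [hwsa] at this
    refine this.trans ?_
    have h0 : 0 ≤ w * w := by nth_rw 1 [← hwsa]; exact star_mul_self_nonneg w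
    gcongr
  have h3 : (starMul (c * w) : A) = w * starMul c * w := by
    rw [coe_starMul, star_mul, hwsa, coe_starMul]; noncomm_ring
  refine (hf.mono ?_).trans (hf.starMul_mul_right_le c hwn)
  rw [h3]
  refine h1.trans ?_
  rw [mul_sub, sub_mul] at h2
  exact sub_le_comm.mp h2

/-- There are contractions `h` with `hxh = (x - η)₊` that are almost right units for all `c` with
`c⋆c ≤ x`. -/
theorem exists_conj_eq_cutDown (x : Pos A) {η : ℝ} (hη : 0 < η) :
    ∃ h : A, star h = h ∧ h * x * h = cutDown x η ∧
      ∀ c : A, star c * c ≤ x → ‖c * h - c‖ ^ 2 ≤ η := by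
  -- Chosen so that `t g(t)² = (t - η)₊` for `t ≥ 0`; then `t (1 - g)² ≤ t (1 - g²) ≤ η` because `0
  -- ≤ g ≤ 1`. The maximum with `η` keeps the denominator positive.
  set g : ℝ → ℝ := fun t => √(max 0 (t - η) / max t η) with hgdef
  have hpos : ∀ t, 0 < max t η := fun t => hη.trans_le (le_max_right _ _)
  have hgc : Continuous g := by
    refine Continuous.sqrt (Continuous.div (by fun_prop) (by fun_prop) fun t => (hpos t).ne')
  have hg0 : g 0 = 0 := by simp [hgdef, hη.le]
  have hgsq : ∀ t, 0 ≤ t → t * (g t * g t) = max 0 (t - η) := by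
    intro t ht
    simp only [hgdef]
    rw [Real.mul_self_sqrt (div_nonneg (le_max_left _ _) (hpos t).le)]
    rcases le_total t η with h | h
    · rw [max_eq_left (by linarith : t - η ≤ 0)]; simp
    · rw [max_eq_left h, mul_div_cancel₀ _ (hη.trans_le h).ne']
  set w : A := cfcₙ g (x : A) with hw
  have hsa : IsSelfAdjoint (x : A) := .of_nonneg x.2
  have hwsa : star w = w := (cfcₙ_predicate g (x : A) : IsSelfAdjoint w).star_eq
  have hid : cfcₙ (fun t : ℝ => t) (x : A) = x := cfcₙ_id' ℝ (x : A)
  have e1 : cfcₙ (fun t => g t * t) (x : A) = w * x := by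
    rw [cfcₙ_mul g (fun t => t) (x : A) (by fun_prop) hg0 (by fun_prop) rfl, hid]
  have e2 : cfcₙ (fun t => t * g t) (x : A) = x * w := by
    rw [cfcₙ_mul (fun t => t) g (x : A) (by fun_prop) rfl (by fun_prop) hg0, hid]
  have e3 : cfcₙ (fun t => g t * t * g t) (x : A) = w * x * w := by
    rw [cfcₙ_mul (fun t => g t * t) g (x : A) (by fun_prop) (by simp) (by fun_prop) hg0, e1]
  refine ⟨w, hwsa, ?_, fun c hc => ?_⟩
  · rw [← e3, coe_cutDown]
    exact cfcₙ_congr_of_nonneg x.2 fun t ht => by rw [← hgsq t ht]; ring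
  · let E : A → A := fun y => y - w * y - y * w + w * y * w
    have hE : ∀ c : A, E (star c * c) = star (c * w - c) * (c * w - c) := by
      intro c
      simp only [E, star_sub, star_mul, hwsa]
      noncomm_ring
    have hpos : 0 ≤ E (star c * c) := by rw [hE]; exact star_mul_self_nonneg _
    have hle : E (star c * c) ≤ E x := by
      obtain ⟨d, hd⟩ := CStarAlgebra.nonneg_iff_eq_star_mul_self.mp (sub_nonneg.mpr hc)
      have : E x - E (star c * c) = E (star d * d) := by
        rw [← hd]; simp only [E]; noncomm_ring
      rw [← sub_nonneg, this, hE]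
      exact star_mul_self_nonneg _
    have hEx : E x = cfcₙ (fun t => t - g t * t - t * g t + g t * t * g t) (x : A) := by
      rw [cfcₙ_add (fun t => t - g t * t - t * g t) (fun t => g t * t * g t) (x : A)
          (by fun_prop) (by simp) (by fun_prop) (by simp),
        cfcₙ_sub (fun t => t - g t * t) (fun t => t * g t) (x : A)
          (by fun_prop) (by simp) (by fun_prop) (by simp),
        cfcₙ_sub (fun t => t) (fun t => g t * t) (x : A)
          (by fun_prop) rfl (by fun_prop) (by simp), hid, e1, e2, e3]
    have hnorm : ‖E x‖ ≤ η := by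
      rw [hEx]
      refine norm_cfcₙ_le fun t ht => ?_
      have ht0 : 0 ≤ t := quasispectrum_nonneg_of_nonneg (x : A) x.2 t ht
      have h1 : t - g t * t - t * g t + g t * t * g t = t * (1 - g t) ^ 2 := by ring
      have h0 : 0 ≤ g t := Real.sqrt_nonneg _
      have h2 : g t ≤ 1 := by
        refine Real.sqrt_le_one.mpr ?_
        rw [div_le_one (hη.trans_le (le_max_right _ _))]
        exact max_le (ht0.trans (le_max_left _ _)) ((by linarith : t - η ≤ t).trans (le_max_left _ _))
      rw [h1, Real.norm_eq_abs, abs_of_nonneg (mul_nonneg ht0 (sq_nonneg _))]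
      have h3 := hgsq t ht0
      have h4 : t - η ≤ max 0 (t - η) := le_max_right _ _
      have h5 : t * (1 - g t) ^ 2 ≤ t * (1 - g t * g t) := by
        refine mul_le_mul_of_nonneg_left ?_ ht0
        nlinarith
      linarith
    have := (CStarAlgebra.norm_le_norm_of_nonneg_of_le hpos hle).trans hnorm
    rwa [hE, CStarRing.norm_star_mul_self, ← sq] at this

theorem continuous_starMul : Continuous (starMul : A → Pos A) :=
  Continuous.subtype_mk (by fun_prop) _

theorem exists_norm_starMul_sub_le (c : A) {δ : ℝ} (hδ : 0 < δ) :
    ∃ η₀ > 0, ∀ d : A, ‖d - c‖ ^ 2 ≤ η₀ → ‖(starMul c : A) - starMul d‖ ≤ δ ∧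
      ‖(starMul (star c) : A) - starMul (star d)‖ ≤ δ := by
  obtain ⟨s, hs, h1⟩ := Metric.continuous_iff.mp (continuous_starMul (A := A)) c δ hδ
  obtain ⟨t, ht, h2⟩ := Metric.continuous_iff.mp
    ((continuous_starMul (A := A)).comp continuous_star) c δ hδ
  refine ⟨(min s t / 2) ^ 2, by positivity, fun d hd => ?_⟩
  have h3 : ‖d - c‖ ≤ min s t / 2 := by
    rwa [sq_le_sq₀ (norm_nonneg _) (by positivity)] at hd
  have h4 : dist d c < min s t := by
    rw [dist_eq_norm]
    have : 0 < min s t := lt_min hs ht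
    linarith
  have h5 := h1 d (h4.trans_le (min_le_left _ _))
  have h6 := h2 d (h4.trans_le (min_le_right _ _))
  rw [dist_comm, Subtype.dist_eq, dist_eq_norm] at h5 h6
  exact ⟨h5.le, h6.le⟩

theorem cutDown_scale {r : ℝ≥0} (hr : 0 < r) (a : Pos A) {ε : ℝ} (hε : 0 ≤ ε) :
    cutDown (scale r a) (r * ε) = scale r (cutDown a ε) := by
  refine Subtype.ext ?_
  have hsa : IsSelfAdjoint (a : A) := .of_nonneg a.2
  rw [coe_cutDown, coe_scale, coe_scale, coe_cutDown,
    ← cfcₙ_comp_smul (r : ℝ) (fun t : ℝ => max 0 (t - r * ε)) (a : A) (by fun_prop)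
      (by simp; positivity),
    ← cfcₙ_smul (r : ℝ) (fun t : ℝ => max 0 (t - ε)) (a : A) (by fun_prop) (by simp [hε])]
  congr 1
  funext t
  rw [smul_eq_mul, smul_eq_mul, ← mul_sub, mul_max_of_nonneg _ _ (NNReal.coe_nonneg r), mul_zero]

/-- The supremum of a tracial weight over the cut-downs of an element. -/
noncomputable def regularize (f : Pos A → ℝ≥0∞) (a : Pos A) : ℝ≥0∞ :=
  ⨆ ε : {ε : ℝ // 0 < ε}, f (cutDown a ε)

theorem le_regularize (f : Pos A → ℝ≥0∞) (a : Pos A) {ε : ℝ} (hε : 0 < ε) :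
    f (cutDown a ε) ≤ regularize f a :=
  le_iSup (fun ε : {ε : ℝ // 0 < ε} => f (cutDown a ε)) ⟨ε, hε⟩

theorem regularize_le {f : Pos A → ℝ≥0∞} {a : Pos A} {c : ℝ≥0∞}
    (h : ∀ ε, 0 < ε → f (cutDown a ε) ≤ c) : regularize f a ≤ c := iSup_le fun ε => h ε ε.2

theorem IsTracial.regularize_le_self {f : Pos A → ℝ≥0∞} (hf : IsTracial f) (a : Pos A) :
    regularize f a ≤ f a := regularize_le fun _ hε => hf.mono (cutDown_le_self a hε.le)

/-- For `≤`, a cut-down of `a + b` is compared with the nearby sum of smaller cut-downs. For `≥`,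
write `a = c⋆c` and `b = d⋆d`: one `h` compresses `a + b` exactly to a cut-down, which splits as
`(ch)⋆(ch) + (dh)⋆(dh)` with summands close to `a` and `b`. -/
theorem IsTracial.regularize_add {f : Pos A → ℝ≥0∞} (hf : IsTracial f) (a b : Pos A) :
    regularize f (a + b) = regularize f a + regularize f b := by
  refine le_antisymm (regularize_le fun ε hε => ?_) ?_
  · refine (hf.cutDown_le_of_norm_sub_le (y := cutDown a (ε / 4) + cutDown b (ε / 4))
      (η := ε / 2) (by linarith) (by linarith) ?_).trans ?_
    · have h1 : ((a + b : Pos A) : A) - (cutDown a (ε / 4) + cutDown b (ε / 4) : Pos A) =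
          ((a : A) - cutDown a (ε / 4)) + ((b : A) - cutDown b (ε / 4)) :=
        add_sub_add_comm (a : A) b (cutDown a (ε / 4)) (cutDown b (ε / 4))
      rw [h1]
      refine (norm_add_le _ _).trans ?_
      have h2 := norm_sub_cutDown_le a (ε := ε / 4) (by linarith)
      have h3 := norm_sub_cutDown_le b (ε := ε / 4) (by linarith)
      linarith
    · rw [hf.map_add]
      exact add_le_add (le_regularize f a (by linarith)) (le_regularize f b (by linarith))
  · have : Nonempty {ε : ℝ // 0 < ε} := ⟨⟨1, one_pos⟩⟩
    refine ENNReal.iSup_add_iSup_le fun ⟨ε, hε⟩ ⟨δ, hδ⟩ => ?_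
    obtain ⟨c, hc⟩ := exists_eq_starMul a
    obtain ⟨d, hd⟩ := exists_eq_starMul b
    obtain ⟨η₁, hη₁, h1⟩ := exists_norm_starMul_sub_le c (half_pos hε)
    obtain ⟨η₂, hη₂, h2⟩ := exists_norm_starMul_sub_le d (half_pos hδ)
    have hη : 0 < min η₁ η₂ := lt_min hη₁ hη₂
    obtain ⟨h, hh, hconj, happ⟩ := exists_conj_eq_cutDown (a + b) hη
    have hca : star c * c ≤ (a + b : Pos A) := by
      rw [hc]; exact le_add_of_nonneg_right (b := (b : A)) b.2
    have hdb : star d * d ≤ (a + b : Pos A) := by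
      rw [hd]; exact le_add_of_nonneg_left (b := (a : A)) a.2
    have h3 := (h1 (c * h) ((happ c hca).trans (min_le_left _ _))).1
    have h4 := (h2 (d * h) ((happ d hdb).trans (min_le_right _ _))).1
    rw [← hc] at h3
    rw [← hd] at h4
    have h5 : starMul (c * h) + starMul (d * h) = cutDown (a + b) (min η₁ η₂) := by
      refine Subtype.ext ?_
      rw [← hconj]
      change star (c * h) * (c * h) + star (d * h) * (d * h) = h * ((a : A) + b) * h
      rw [hc, hd, coe_starMul, coe_starMul, star_mul, star_mul, hh]
      noncomm_ring
    calc f (cutDown a ε) + f (cutDown b δ)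
        ≤ f (starMul (c * h)) + f (starMul (d * h)) :=
          add_le_add (hf.cutDown_le_of_norm_sub_le (by linarith) (by linarith) h3)
            (hf.cutDown_le_of_norm_sub_le (by linarith) (by linarith) h4)
      _ = f (cutDown (a + b) (min η₁ η₂)) := by rw [← hf.map_add, h5]
      _ ≤ _ := le_regularize f _ hη

/-- Choose `h` so that `(xh)⋆(xh)` is a cut-down of `x⋆x` while `(xh)(xh)⋆` is close to `xx⋆`, and
exchange the two by the trace property of `f`. -/
theorem IsTracial.regularize_star_le {f : Pos A → ℝ≥0∞} (hf : IsTracial f) (x : A) :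
    regularize f (starMul (star x)) ≤ regularize f (starMul x) := by
  refine regularize_le fun ε hε => ?_
  obtain ⟨η, hη, h1⟩ := exists_norm_starMul_sub_le x (half_pos hε)
  obtain ⟨h, hh, hconj, happ⟩ := exists_conj_eq_cutDown (starMul x) hη
  have h2 := (h1 (x * h) (happ x le_rfl)).2
  have h3 : starMul (x * h) = cutDown (starMul x) η := by
    refine Subtype.ext ?_
    rw [← hconj, coe_starMul, coe_starMul, star_mul, hh]
    noncomm_ring
  calc f (cutDown (starMul (star x)) ε) ≤ f (starMul (star (x * h))) :=
        hf.cutDown_le_of_norm_sub_le (by linarith) (by linarith) h2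
    _ = f (cutDown (starMul x) η) := by rw [hf.map_star, h3]
    _ ≤ _ := le_regularize f _ hη

theorem IsTracial.lowerSemicontinuous_regularize {f : Pos A → ℝ≥0∞} (hf : IsTracial f) :
    LowerSemicontinuous (regularize f) := by
  intro a r hr
  obtain ⟨⟨ε, hε⟩, h⟩ := lt_iSup_iff.mp hr
  filter_upwards [Metric.ball_mem_nhds a (show 0 < ε / 4 by linarith)] with b hb
  refine h.trans_le ((hf.cutDown_le_of_norm_sub_le (η := ε / 2) (y := cutDown b (ε / 4))
    (by linarith) (by linarith) ?_).trans (le_regularize f b (by linarith)))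
  rw [Metric.mem_ball, dist_comm, Subtype.dist_eq, dist_eq_norm] at hb
  have h2 := norm_sub_cutDown_le b (ε := ε / 4) (by linarith)
  have h3 : (a : A) - cutDown b (ε / 4) = ((a : A) - b) + ((b : A) - cutDown b (ε / 4)) := by abel
  rw [h3]
  exact (norm_add_le _ _).trans (by linarith)

/-- The lower-semicontinuous trace obtained by regularizing a tracial weight. -/
noncomputable def IsTracial.toTrace {f : Pos A → ℝ≥0∞} (hf : IsTracial f) : Trace A where
  toFun := regularize f
  map_zero' := le_zero_iff.mp (hf.map_zero ▸ hf.regularize_le_self 0)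
  map_add' := hf.regularize_add
  map_smul' r a hr := by
    change regularize f (scale r a) = r * regularize f a
    refine le_antisymm (regularize_le fun ε hε => ?_) ?_
    · have hr' : (0 : ℝ) < r := hr
      have h1 : ε = r * (ε / r) := by field_simp
      rw [h1, cutDown_scale hr a (by positivity), hf.map_scale_le]
      gcongr
      exact le_regularize f a (by positivity)
    · rw [regularize, ENNReal.mul_iSup]
      refine iSup_le fun ε => ?_
      rw [← hf.map_scale_le, ← cutDown_scale hr a ε.2.le]
      exact le_regularize f _ (mul_pos (by exact_mod_cast hr) ε.2)
  map_mul_star' x := by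
    rw [← starMul_star]
    refine le_antisymm (hf.regularize_star_le x) ?_
    have := hf.regularize_star_le (star x)
    rwa [star_star] at this
  lsc' := hf.lowerSemicontinuous_regularize

theorem IsTracial.toTrace_apply {f : Pos A → ℝ≥0∞} (hf : IsTracial f) (a : Pos A) :
    hf.toTrace a = regularize f a := rfl

end Trace

end Regularization


/-! ### Compactness in the cone of traces -/

section TraceCompactness

open Filter Topology

variable {A : Type u} [NonUnitalCStarAlgebra A] [PartialOrder A] [StarOrderedRing A]

namespace Trace

/-- If a proper filter converges to both `σ` and `τ`, then `σ((a - ε)₊) ≤ liminf ≤ limsup ≤ τ(a)`;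
let `ε` tend to 0. The separation axiom also lets one compact neighbourhood of each point suffice
for local compactness. -/
instance : T2Space (Trace A) := by
  refine t2_iff_nhds.mpr fun {σ τ} h => ?_
  have key : ∀ {σ τ : Trace A}, ConvergesTo (𝓝 σ ⊓ 𝓝 τ) σ → ConvergesTo (𝓝 σ ⊓ 𝓝 τ) τ →
      (𝓝 σ ⊓ 𝓝 τ).NeBot → ∀ a, σ a ≤ τ a := by
    intro σ τ hσ hτ hne a
    refine σ.le_of_forall_cutDown_le fun ε hε => ?_
    exact (hσ (cutDown a ε) 1 one_pos).2.trans
      ((liminf_le_limsup (f := 𝓝 σ ⊓ 𝓝 τ)).trans (hτ a ε hε).1)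
  have h1 := (le_nhds_iff _ σ).mp (inf_le_left : 𝓝 σ ⊓ 𝓝 τ ≤ 𝓝 σ)
  have h2 := (le_nhds_iff _ τ).mp (inf_le_right : 𝓝 σ ⊓ 𝓝 τ ≤ 𝓝 τ)
  refine ext fun a => le_antisymm (key h1 h2 h a) ?_
  rw [inf_comm] at h1 h2 h
  exact key h2 h1 h a

/-- Every ultrafilter on the cone of traces converges to the regularization of its pointwise
limit. -/
theorem exists_convergesTo (F : Ultrafilter (Trace A)) :
    ∃ (f : Pos A → ℝ≥0∞) (hf : IsTracial f),
      (∀ a, Tendsto (fun σ : Trace A => σ a) F (𝓝 (f a))) ∧ ConvergesTo F hf.toTrace := by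
  have hex : ∀ a : Pos A, ∃ l : ℝ≥0∞, Tendsto (fun σ : Trace A => σ a) F (𝓝 l) := fun a =>
    ⟨_, (F.map fun σ : Trace A => σ a).le_nhds_lim⟩
  choose f hlim using hex
  have hf : IsTracial f :=
    { map_zero := tendsto_nhds_unique (hlim 0) (by
        simp only [fun σ : Trace A => σ.isTracial.map_zero]; exact tendsto_const_nhds)
      map_add := fun a b => tendsto_nhds_unique (hlim (a + b)) (by
        simp only [fun σ : Trace A => σ.isTracial.map_add]; exact (hlim a).add (hlim b))
      map_smul := fun r a _ => tendsto_nhds_unique (hlim (scale r a)) (by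
        simp only [fun σ : Trace A => σ.isTracial.map_scale_le]
        exact ENNReal.Tendsto.const_mul (hlim a) (Or.inr ENNReal.coe_ne_top))
      map_star := fun x => tendsto_nhds_unique (hlim _) (by
        simp only [fun σ : Trace A => σ.isTracial.map_star]; exact hlim _) }
  refine ⟨f, hf, hlim, fun a ε hε => ⟨?_, ?_⟩⟩
  · rw [(hlim _).limsup_eq]
    exact le_regularize f a hε
  · rw [(hlim _).liminf_eq]
    exact hf.regularize_le_self a

/-- Cutting down further by `η` loses at most `η`, and only where `t > ε`; there `t - ε / 2 ≥ ε /
2`, whence the factor `2 / ε`. The error term is a multiple of an element at which the weight will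
be finite. -/
theorem cutDown_le_cutDown_add (a : Pos A) {ε η : ℝ} (hε : 0 < ε) (hη : 0 ≤ η) :
    (cutDown a ε : A) ≤ (cutDown (cutDown a ε) η : A) + (η * (2 / ε)) • (cutDown a (ε / 2) : A) := by
  have hsa : IsSelfAdjoint (a : A) := .of_nonneg a.2
  have z1 : max 0 (0 - (ε + η)) = 0 := max_eq_left (by linarith)
  have z2 : max 0 (0 - ε / 2) = 0 := max_eq_left (by linarith)
  rw [cutDown_cutDown a hε.le hη, coe_cutDown, coe_cutDown, coe_cutDown,
    ← cfcₙ_const_mul (η * (2 / ε)) (fun t : ℝ => max 0 (t - ε / 2)) (a : A) (by fun_prop)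
      z2,
    ← cfcₙ_add (fun t : ℝ => max 0 (t - (ε + η))) (fun t : ℝ => η * (2 / ε) * max 0 (t - ε / 2))
      (a : A) (by fun_prop) z1 (by fun_prop) (by rw [z2, mul_zero])]
  refine cfcₙ_mono_of_nonneg a.2 (by fun_prop) (by fun_prop) (by simp [hε.le])
    (by rw [z1, z2, mul_zero, add_zero]) fun t ht => ?_
  have h1 : 0 ≤ max 0 (t - (ε + η)) := le_max_left _ _
  have h2 : 0 ≤ η * (2 / ε) * max 0 (t - ε / 2) := by positivity
  refine max_le (add_nonneg h1 h2) ?_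
  rcases le_total t ε with h | h
  · linarith
  · have h3 : t - (ε + η) ≤ max 0 (t - (ε + η)) := le_max_right _ _
    have h4 : η ≤ η * (2 / ε) * max 0 (t - ε / 2) := by
      have h5 : η * (2 / ε) * (ε / 2) = η := by field_simp
      calc η = η * (2 / ε) * (ε / 2) := h5.symm
        _ ≤ η * (2 / ε) * max 0 (t - ε / 2) := by
          gcongr
          exact le_trans (by linarith) (le_max_right _ _)
    linarith

/-- A tracial weight that is finite on all cut-downs of elements of `I` agrees with its
regularization on the Pedersen ideal of `I`. -/
theorem IsTracial.regularize_eq_of_mem_pedersenIdeal {f : Pos A → ℝ≥0∞} (hf : IsTracial f)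
    {I : ClosedIdeal A}
    (hfin : ∀ a : Pos A, (a : A) ∈ I → ∀ ε, 0 < ε → f (cutDown a ε) < ∞) {e : I}
    (he : 0 ≤ (e : A)) (heP : e ∈ pedersenIdeal I) :
    regularize f ⟨e, he⟩ = f ⟨e, he⟩ := by
  have hp := IsTracial.isIdealPredicate_eq hf.toTrace.isTracial hf hf.regularize_le_self
  refine (hp.of_mem_pedersenIdeal (fun a ha ε hε => ?_) he heP).1
  refine ⟨le_antisymm (hf.regularize_le_self _) ?_, hfin a ha ε hε⟩
  change f (cutDown a ε) ≤ regularize f (cutDown a ε)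
  set K := f (cutDown a (ε / 2)) with hK
  have hKfin : K < ∞ := hfin a ha _ (by linarith)
  -- The error is `η` times a finite constant, so letting `η` tend to 0 shows that `f` and its
  -- regularization agree on cut-downs. Being an ideal predicate, agreement extends to the Pedersen
  -- ideal.
  have hstep : ∀ η : ℝ≥0, 0 < η →
      f (cutDown a ε) ≤ regularize f (cutDown a ε) + (η * (2 / ε).toNNReal : ℝ≥0) * K := by
    intro η hη
    have h1 : (cutDown a ε : A) ≤ (cutDown (cutDown a ε) η +
        scale (η * (2 / ε).toNNReal) (cutDown a (ε / 2)) : Pos A) := by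
      refine (cutDown_le_cutDown_add a hε η.2).trans_eq ?_
      change _ = (cutDown (cutDown a ε) η : A) + scale (η * (2 / ε).toNNReal) (cutDown a (ε / 2))
      rw [coe_scale, NNReal.coe_mul, Real.coe_toNNReal _ (by positivity)]
      rfl
    refine (hf.mono h1).trans ?_
    rw [hf.map_add, hf.map_scale_le]
    gcongr
    exact le_regularize f _ hη
  have hlim : Tendsto (fun η : ℝ≥0 => regularize f (cutDown a ε) +
      (η * (2 / ε).toNNReal : ℝ≥0) * K) (𝓝[>] 0) (𝓝 (regularize f (cutDown a ε) + 0 * K)) := by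
    refine Tendsto.mono_left ?_ nhdsWithin_le_nhds
    refine tendsto_const_nhds.add (ENNReal.Tendsto.mul_const ?_ (Or.inr hKfin.ne))
    have : Tendsto (fun η : ℝ≥0 => η * (2 / ε).toNNReal) (𝓝 0) (𝓝 (0 * (2 / ε).toNNReal)) :=
      tendsto_id.mul_const _
    rw [zero_mul] at this
    exact ENNReal.tendsto_coe.mpr this
  rw [zero_mul, add_zero] at hlim
  exact ge_of_tendsto hlim (eventually_nhdsWithin_of_forall hstep)

/-- Limits of ultrafilters on `T_I(A)` that are bounded at a full positive element of the Pedersen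
ideal of `I`. -/
theorem exists_convergesTo_supportedOn {I : ClosedIdeal A} {e : I} (he : 0 ≤ (e : A))
    (heP : e ∈ pedersenIdeal I) (hef : IsFull e) (F : Ultrafilter (Trace A)) {R : ℝ≥0}
    (hF : ∀ᶠ σ in F, σ ∈ supportedOn I ∧ σ ⟨e, he⟩ ≤ R) :
    ∃ τ ∈ supportedOn I, (F : Filter (Trace A)) ≤ 𝓝 τ ∧
      Tendsto (fun σ : Trace A => σ ⟨e, he⟩) F (𝓝 (τ ⟨e, he⟩)) := by
  obtain ⟨f, hf, hlim, hconv⟩ := exists_convergesTo F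
  have hfin : ∀ a : Pos A, (a : A) ∈ I → ∀ ε, 0 < ε → f (cutDown a ε) < ∞ := by
    intro a ha ε hε
    obtain ⟨C, hC⟩ := exists_forall_cutDown_le_mul (A := A) (e := ⟨(e : A), he⟩) (a := a)
      (by rw [ClosedIdeal.isFull_iff.mp hef]; exact ha) hε
    have h1 : f (cutDown a ε) ≤ C * R := by
      refine le_of_tendsto (hlim _) ?_
      filter_upwards [hF] with σ hσ
      refine (hC σ).trans ?_
      gcongr
      exact hσ.2
    exact h1.trans_lt (ENNReal.mul_lt_top ENNReal.coe_lt_top ENNReal.coe_lt_top)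
  refine ⟨hf.toTrace, mem_supportedOn_iff.mpr ⟨fun a ha ε hε => ?_, fun a ha => ?_⟩,
    (le_nhds_iff _ _).mpr hconv, ?_⟩
  · exact (hf.regularize_le_self _).trans_lt (hfin a ha ε hε)
  · have := mt (mem_of_forall_cutDown_mem I) ha
    push Not at this
    obtain ⟨ε, hε, h⟩ := this
    have h1 : ∞ ≤ f (cutDown a ε) := by
      refine ge_of_tendsto (hlim _) ?_
      filter_upwards [hF] with σ hσ
      exact ((mem_supportedOn_iff.mp hσ.1).2 _ h).ge
    exact top_le_iff.mp (h1.trans (le_regularize f a hε))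
  · rw [hf.toTrace_apply, hf.regularize_eq_of_mem_pedersenIdeal hfin he heP]
    exact hlim _

theorem isCompact_setOf_le {I : ClosedIdeal A} {e : I} (he : 0 ≤ (e : A))
    (heP : e ∈ pedersenIdeal I) (hef : IsFull e) (R : ℝ≥0) :
    IsCompact {σ : Trace A | σ ∈ supportedOn I ∧ σ ⟨e, he⟩ ≤ R} := by
  rw [isCompact_iff_ultrafilter_le_nhds]
  intro F hF
  obtain ⟨τ, hτ, hle, hlim⟩ := exists_convergesTo_supportedOn he heP hef F (R := R)
    (le_principal_iff.mp hF)
  refine ⟨τ, ⟨hτ, le_of_tendsto hlim ?_⟩, hle⟩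
  filter_upwards [le_principal_iff.mp hF] with σ hσ using hσ.2

theorem isCompact_normalizedAt {I : ClosedIdeal A} {e : I} (he : 0 ≤ (e : A))
    (heP : e ∈ pedersenIdeal I) (hef : IsFull e) : IsCompact (normalizedAt I ⟨e, he⟩) := by
  rw [isCompact_iff_ultrafilter_le_nhds]
  intro F hF
  have hF' : ∀ᶠ σ in F, σ ∈ supportedOn I ∧ σ ⟨e, he⟩ = 1 := le_principal_iff.mp hF
  obtain ⟨τ, hτ, hle, hlim⟩ := exists_convergesTo_supportedOn he heP hef F (R := 1)
    (hF'.mono fun σ hσ => ⟨hσ.1, by rw [hσ.2, ENNReal.coe_one]⟩)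
  refine ⟨τ, ⟨hτ, tendsto_nhds_unique hlim ?_⟩, hle⟩
  exact tendsto_const_nhds.congr' (hF'.mono fun σ hσ => hσ.2.symm)

theorem lt_top_of_mem_pedersenIdeal {I : ClosedIdeal A} {τ : Trace A} (hτ : τ ∈ supportedOn I)
    {e : I} (he : 0 ≤ (e : A)) (heP : e ∈ pedersenIdeal I) : τ ⟨e, he⟩ < ∞ :=
  τ.isTracial.isIdealPredicate_lt_top.of_mem_pedersenIdeal (mem_supportedOn_iff.mp hτ).1 he heP

/-- The null set of `τ` is an ideal predicate, and lower semicontinuity extends its vanishing to the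
closed ideal generated by `e`. -/
theorem eq_ofIdeal_of_apply_eq_zero {I : ClosedIdeal A} {τ : Trace A} (hτ : τ ∈ supportedOn I)
    {e : Pos A} (hef : ClosedIdeal.span {(e : A)} = I) (h0 : τ e = 0) : τ = ofIdeal I := by
  have hp := τ.isTracial.isIdealPredicate_eq_zero
  have hle : I ≤ hp.isTwoSidedIdeal_sqIdeal.closure := by
    rw [← hef, ClosedIdeal.span_singleton_le]
    obtain ⟨c, rfl⟩ := exists_eq_starMul e
    exact IsTwoSidedIdeal.subset_closure _ (hp.isTwoSidedIdeal_sqIdeal _ c h0).1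
  refine ext fun a => ?_
  by_cases ha : (a : A) ∈ I
  · rw [ofIdeal_of_mem ha]
    exact τ.eq_zero_of_mem_closure hp.isTwoSidedIdeal_sqIdeal (fun x hx => hx) (hle ha)
  · rw [ofIdeal_of_notMem ha, (mem_supportedOn_iff.mp hτ).2 a ha]

theorem convex_normalizedAt (I : ClosedIdeal A) (e : Pos A) : Convex ℝ≥0 (normalizedAt I e) := by
  intro σ hσ τ hτ s t _ _ hst
  -- Zero coefficients need separate treatment: `0 • σ` is the zero trace, as `0 * ∞ = 0`, and not
  -- the neutral element `τ_I`.
  rcases eq_or_ne s 0 with rfl | hs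
  · rw [zero_add] at hst
    rw [hst, zero_smul, one_smul, zero_add]; exact hτ
  rcases eq_or_ne t 0 with rfl | ht
  · rw [add_zero] at hst
    rw [hst, zero_smul, one_smul, add_zero]; exact hσ
  have hC := isSubcone_supportedOn I
  refine ⟨hC.add_mem _ (hC.smul_mem s (pos_iff_ne_zero.mpr hs) _ hσ.1) _
    (hC.smul_mem t (pos_iff_ne_zero.mpr ht) _ hτ.1), ?_⟩
  rw [add_apply, smul_apply, smul_apply, hσ.2, hτ.2, mul_one, mul_one]
  exact_mod_cast hst

/-- The scaling factor of `τ` is forced to be `τ(e)`: it is finite because `e` is in the Pedersen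
ideal, and nonzero because `e` is full and `τ ≠ τ_I`. -/
theorem isCompactBase_normalizedAt {I : ClosedIdeal A} {e : I} (he : 0 ≤ (e : A))
    (heP : e ∈ pedersenIdeal I) (hef : IsFull e) :
    IsCompactBase (supportedOn I) (ofIdeal I) (normalizedAt I ⟨e, he⟩) where
  subset _ h := h.1
  isCompact := isCompact_normalizedAt he heP hef
  convex := convex_normalizedAt I _
  neutral_notMem h := by
    have h1 : ofIdeal I ⟨e, he⟩ = 0 := ofIdeal_of_mem e.2
    exact zero_ne_one (h1.symm.trans h.2)
  existsUnique τ hτ hne := by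
    have hspan : ClosedIdeal.span {(e : A)} = I := ClosedIdeal.isFull_iff.mp hef
    have h0 : τ ⟨e, he⟩ ≠ 0 := fun h =>
      hne (eq_ofIdeal_of_apply_eq_zero (e := ⟨(e : A), he⟩) hτ hspan h)
    have htop : τ ⟨e, he⟩ ≠ ∞ := (lt_top_of_mem_pedersenIdeal hτ he heP).ne
    obtain ⟨r, hr⟩ : ∃ r : ℝ≥0, (r : ℝ≥0∞) = τ ⟨e, he⟩ := ⟨_, ENNReal.coe_toNNReal htop⟩
    have hr0 : 0 < r := by
      rw [pos_iff_ne_zero]; rintro rfl; exact h0 (by rw [← hr, ENNReal.coe_zero])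
    have hmem : r⁻¹ • τ ∈ supportedOn I :=
      (isSubcone_supportedOn I).smul_mem r⁻¹ (inv_pos.mpr hr0) τ hτ
    have hsm : r • r⁻¹ • τ = τ := by rw [smul_smul, mul_inv_cancel₀ hr0.ne', one_smul]
    refine ⟨(r, r⁻¹ • τ), ⟨hr0, ⟨hmem, ?_⟩, hsm⟩, ?_⟩
    · rw [smul_apply, ← hr, ← ENNReal.coe_mul, inv_mul_cancel₀ hr0.ne', ENNReal.coe_one]
    · rintro ⟨s, σ⟩ ⟨hs, ⟨-, hσ1⟩, hsσ⟩
      dsimp only at hs hσ1 hsσ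
      have h1 : s = r := by
        rw [← hsσ, smul_apply, hσ1, mul_one] at hr
        exact_mod_cast hr.symm
      rw [← hsσ, h1, smul_smul, inv_mul_cancel₀ hr0.ne', one_smul]

/-- Convergence to `τ` directly bounds from above only values at cut-downs, so the neighbourhood is
a sublevel set at `(e - ε)₊`. For small `ε` this cut-down is still full and in the Pedersen ideal,
which makes the sublevel set compact. -/
theorem locallyCompactSpace_supportedOn {I : ClosedIdeal A} {e : I} (he : 0 ≤ (e : A))
    (heP : e ∈ pedersenIdeal I) (hef : IsFull e) : LocallyCompactSpace (supportedOn I) := by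
  have : WeaklyLocallyCompactSpace (supportedOn I) := by
    refine ⟨fun τ => ?_⟩
    obtain ⟨ε, hε, hs⟩ := ClosedIdeal.exists_span_cutDown_eq
      (A := A) (ClosedIdeal.isCompactElement_of_isFull heP hef) (b := ⟨(e : A), he⟩)
      (ClosedIdeal.isFull_iff.mp hef)
    have hmem : (cutDown (⟨(e : A), he⟩ : Pos A) ε : A) ∈ I := cutDown_mem I (a := ⟨(e : A), he⟩) e.2 ε
    have hK := isCompact_setOf_le (e := ⟨_, hmem⟩) (cutDown (⟨(e : A), he⟩ : Pos A) ε).2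
      (cutDown_mem_pedersenIdeal I (a := ⟨(e : A), he⟩) e.2 hε) (ClosedIdeal.isFull_iff.mpr hs)
      -- The added 1 makes the bound strictly larger than `τ(e)`, hence than the limsup of `σ((e -
      -- ε)₊)` at `τ`, so it holds near `τ`.
      ((τ.1 ⟨e, he⟩).toNNReal + 1)
    refine ⟨Subtype.val ⁻¹' _, Topology.IsInducing.subtypeVal.isCompact_preimage'
      hK fun σ hσ => ⟨⟨σ, hσ.1⟩, rfl⟩, ?_⟩
    have hlt : τ.1 ⟨e, he⟩ < (((τ.1 ⟨e, he⟩).toNNReal + 1 : ℝ≥0) : ℝ≥0∞) := by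
      have h1 := (lt_top_of_mem_pedersenIdeal τ.2 he heP).ne
      rw [ENNReal.coe_add, ENNReal.coe_toNNReal h1, ENNReal.coe_one]
      exact ENNReal.lt_add_right h1 one_ne_zero
    have hconv := ((le_nhds_iff (𝓝 τ.1) τ.1).mp le_rfl ⟨e, he⟩ ε hε).1.trans_lt hlt
    have hev := continuous_subtype_val.continuousAt.eventually (eventually_lt_of_limsup_lt hconv)
    filter_upwards [hev] with σ hσ
    exact ⟨σ.2, hσ.le⟩
  infer_instance

end Trace

end TraceCompactness

end CStarTrace

theorem mainTheorem9 {A : Type u} [NonUnitalCStarAlgebra A] [PartialOrder A] [StarOrderedRing A]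
    (I : CStarTrace.ClosedIdeal A) :
    List.TFAE
      [I.IsSinglyGenerated ∧ IsCompactElement I,
        ∃ e : I, e ∈ CStarTrace.pedersenIdeal I ∧ CStarTrace.IsFull e,
        CompactSpace (CStarTrace.Prim I)] ∧
    ((I.IsSinglyGenerated ∧ IsCompactElement I) ∨
        (∃ e : I, e ∈ CStarTrace.pedersenIdeal I ∧ CStarTrace.IsFull e) ∨
        CompactSpace (CStarTrace.Prim I) →
      CStarTrace.Trace.IsSubcone (CStarTrace.Trace.supportedOn I) (CStarTrace.Trace.ofIdeal I) ∧
      CStarTrace.Trace.IsCancellative (CStarTrace.Trace.supportedOn I) ∧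
      LocallyCompactSpace (CStarTrace.Trace.supportedOn I) ∧
      (∃ e : I, 0 ≤ (e : A) ∧ e ∈ CStarTrace.pedersenIdeal I ∧ CStarTrace.IsFull e) ∧
      ∀ (e : I) (he : 0 ≤ (e : A)), e ∈ CStarTrace.pedersenIdeal I → CStarTrace.IsFull e →
        CStarTrace.Trace.IsCompactBase (CStarTrace.Trace.supportedOn I)
          (CStarTrace.Trace.ofIdeal I) (CStarTrace.Trace.normalizedAt I ⟨(e : A), he⟩)) := by
  have htfae := I.tfae_compact
  refine ⟨htfae, fun h => ?_⟩
  have hc : CompactSpace (CStarTrace.Prim I) := by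
    rcases h with h | h | h
    · exact (htfae.out 0 2).mp h
    · exact (htfae.out 1 2).mp h
    · exact h
  obtain ⟨c, hcP, hcf⟩ := CStarTrace.exists_isFull_of_compactSpace_prim (A := I)
  -- The witness comes in the form `c⋆c`, so its positivity can be read off in the order of `A`.
  have hc0 : 0 ≤ ((star c * c : I) : A) := star_mul_self_nonneg (c : A)
  exact ⟨CStarTrace.Trace.isSubcone_supportedOn I, CStarTrace.Trace.isCancellative_supportedOn I,
    CStarTrace.Trace.locallyCompactSpace_supportedOn hc0 hcP hcf, ⟨_, hc0, hcP, hcf⟩,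
    fun _ he heP hef => CStarTrace.Trace.isCompactBase_normalizedAt he heP hef⟩
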